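/- Let $\mu,\gamma>0$. Consider the (dimensionless) bouncing ball made of a lower point mass at height $x(t)\ge 0$ and an upper point mass at height $y(t)\in\mathbb R$, connected by a dissipative spring, above a floor at height $0$. While $x>0$ the motion obeys \[ \ddot x+\mu\dot x+\tfrac12x=-\gamma-\tfrac12+\tfrac12y+\mu\dot y,\qquad \ddot y+\mu\dot y+\tfrac12y=-\gamma+\tfrac12+\tfrac12x+\mu\dot x . \] The function $x$ is continuous and $y$ is continuously differentiable, and at each time $t$ with $x(t)=0$ the lower mass is reflected elastically, $\dot x(t^+)=-\dot x(t^-)$. The lower mass may also rest on the floor during an interval of time; then $x=0$, $\ddot y+\mu\dot y+\tfrac12y=-\gamma+\tfrac12$, and the force on the lower mass satisfies $F=\tfrac12y+\mu\dot y-\gamma-\tfrac12\le0$. A motion on $[0,T)$, $0<T\le\infty$, is one obeying these rules such that every $t\in[0,T)$ has one-sided neighbourhoods in $[0,T)$ (on the right and, if $t>0$, on the left), not containing $t$, on each of which either $x>0$ throughout or $x=0$ throughout. An impact is a time $t$ with $x(t)=0$ and $\dot x(t^+)\neq0$. An initial condition consists of the values $x_0\ge0$, $\dot x_0$, $y_0$,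 $\dot y_0$ at time $0$; if $x_0=0$, the motion starts with $\dot x(0^+)=|\dot x_0|$. Then for every initial condition: 1. There is a motion on $[0,\infty)$ with this initial condition. 2. There is no inelastic collapse: every motion with this initial condition on a bounded interval $[0,T)$, $0<T<\infty$, has only finitely many impacts and extends to a motion on $[0,\infty)$. 3. For every motion on $[0,\infty)$ with this initial condition, one of the following holds. (a) There is $t_*\ge0$ such that for all $t>t_*$ the lower mass remains in contact with the floor, $x(t)=0$, while the upper mass performs damped harmonic oscillations, $\ddot y+\mu\dot y+\tfrac12y=-\gamma+\tfrac12$; in particular $y(t)\to1-2\gamma$ and $\dot y(t)\to0$ as $t\to\infty$. (b) There are infinitely many impacts; they form an increasing sequence $t_0<t_1<t_2<\cdots$ with $t_n\to\infty$, from some time on every contact ($x(t)=0$) is an impact, and the times of flight $\tau_n=t_{n+1}-t_n$ satisfy \[ \tau_n\sim\frac{3}{\mu}\,\frac1n\qquad(n\to\infty). \] -/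

import Mathlib

open Filter Topology Set Asymptotics

namespace BouncingBall

/-- A state of the ball: position `x` and velocity `v` of the lower point mass, position `y` and
velocity `w` of the upper point mass (in dimensionless units). -/
@[ext]
structure State where
  x : ℝ
  v : ℝ
  y : ℝ
  w : ℝ

/-- Acceleration of the lower mass when only gravity and the dissipative spring act on it:
`x'' + μ x' + x / 2 = -γ - 1 / 2 + y / 2 + μ y'`. -/
noncomputable def lowerAcc (μ γ : ℝ) (s : State) : ℝ :=
  -γ - 1 / 2 + s.y / 2 + μ * s.w - μ * s.v - s.x / 2

/-- Acceleration of the upper mass, on which only gravity and the dissipative spring act: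
`y'' + μ y' + y / 2 = -γ + 1 / 2 + x / 2 + μ x'`. -/
noncomputable def upperAcc (μ γ : ℝ) (s : State) : ℝ :=
  -γ + 1 / 2 + s.x / 2 + μ * s.v - μ * s.w - s.y / 2

/-- The force `F = y / 2 + μ y' - γ - 1 / 2` that gravity and the spring exert on the lower mass
while it is at rest on the floor. -/
noncomputable def floorForce (μ γ : ℝ) (s : State) : ℝ :=
  s.y / 2 + μ * s.w - γ - 1 / 2

/-- The time interval `[0, T)`, where `T` may be infinite. -/
def timeDomain (T : EReal) : Set ℝ := {t | 0 ≤ t ∧ (t : EReal) < T}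

/-- `u` is a motion of the ball on the time interval `[0, T)`. The velocity `(u t).v` of the lower
mass is taken right-continuous, i.e. it is the velocity just after `t`. The last two fields
say that contacts with the floor (instantaneous ones, or whole intervals of contact) do not
accumulate at any time of `[0, T)`; they may accumulate at `T`. -/
structure IsMotion (μ γ : ℝ) (T : EReal) (u : ℝ → State) : Prop where
  /-- The lower mass stays above the floor. -/
  nonneg : ∀ t ∈ timeDomain T, 0 ≤ (u t).x
  /-- The position of the lower mass is continuous. -/
  cont_x : ContinuousOn (fun t => (u t).x) (timeDomain T)
  /-- `(u t).v` is the right derivative of the position of the lower mass. -/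
  right_deriv_x : ∀ t ∈ timeDomain T,
    HasDerivWithinAt (fun s => (u s).x) (u t).v (Ioi t) t
  /-- `(u t).v` is the velocity just after `t`. -/
  right_cont_v : ∀ t ∈ timeDomain T, Tendsto (fun s => (u s).v) (𝓝[>] t) (𝓝 (u t).v)
  /-- The upper mass has velocity `(u t).w` ... -/
  deriv_y : ∀ t ∈ timeDomain T,
    HasDerivWithinAt (fun s => (u s).y) (u t).w (timeDomain T) t
  /-- ... which is continuous, also across impacts. -/
  cont_w : ContinuousOn (fun t => (u t).w) (timeDomain T)
  /-- The equations of motion in free flight. -/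
  flight : ∀ t ∈ timeDomain T, 0 < t → 0 < (u t).x →
    HasDerivAt (fun s => (u s).x) (u t).v t ∧
    HasDerivAt (fun s => (u s).v) (lowerAcc μ γ (u t)) t ∧
    HasDerivAt (fun s => (u s).w) (upperAcc μ γ (u t)) t
  /-- Elastic contacts with the floor: the velocity after is minus the velocity before. -/
  impact : ∀ t ∈ timeDomain T, 0 < t → (u t).x = 0 →
    Tendsto (fun s => (u s).v) (𝓝[<] t) (𝓝 (-(u t).v))
  /-- While the lower mass rests on the floor, the upper one obeys its equation of motion, and the
  lower one is pressed against the floor (whose reaction can only push). -/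
  contact : ∀ t ∈ timeDomain T, 0 < t → (∀ᶠ s in 𝓝 t, (u s).x = 0) →
    HasDerivAt (fun s => (u s).w) (upperAcc μ γ (u t)) t ∧ floorForce μ γ (u t) ≤ 0
  /-- Just after any time the ball is either in free flight or resting on the floor. -/
  mode_right : ∀ t ∈ timeDomain T,
    (∀ᶠ s in 𝓝[>] t, 0 < (u s).x) ∨ (∀ᶠ s in 𝓝[>] t, (u s).x = 0)
  /-- Just before any positive time the ball is either in free flight or resting on the floor. -/
  mode_left : ∀ t ∈ timeDomain T, 0 < t →
    (∀ᶠ s in 𝓝[<] t, 0 < (u s).x) ∨ (∀ᶠ s in 𝓝[<] t, (u s).x = 0)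

/-- The motion `u` starts from the initial condition `s`. If the lower mass is initially on the
floor, moving downwards, then its velocity is reversed at once. -/
def StartsFrom (u : ℝ → State) (s : State) : Prop :=
  (u 0).x = s.x ∧ (u 0).v = (if s.x = 0 then |s.v| else s.v) ∧ (u 0).y = s.y ∧ (u 0).w = s.w

/-- The times in `[0, T)` of the instantaneous impacts: the lower mass is on the floor and
exchanges momentum with it. -/
def impactTimes (T : EReal) (u : ℝ → State) : Set ℝ :=
  {t | t ∈ timeDomain T ∧ (u t).x = 0 ∧ (u t).v ≠ 0}

/-- First outcome: from some time on the lower mass stays on the floor, while the upper mass obeys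
the equation `y'' + μ y' + y / 2 = -γ + 1 / 2` of a damped harmonic oscillator, and its
oscillations die out around the equilibrium position `1 - 2 γ`. -/
def EndsInContact (μ γ : ℝ) (u : ℝ → State) : Prop :=
  (∃ t₀ : ℝ, 0 ≤ t₀ ∧ ∀ t > t₀, (u t).x = 0 ∧
    HasDerivAt (fun s => (u s).y) (u t).w t ∧
    HasDerivAt (fun s => (u s).w) (-γ + 1 / 2 - μ * (u t).w - (u t).y / 2) t) ∧
  Tendsto (fun t => (u t).y) atTop (𝓝 (1 - 2 * γ)) ∧
  Tendsto (fun t => (u t).w) atTop (𝓝 0)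

/-- Second outcome: the impact times form an infinite increasing sequence `t 0 < t 1 < ...` that
tends to infinity, from some time on all contacts with the floor are impacts, and the times
of flight satisfy `t (n + 1) - t n ∼ (3 / μ) (1 / n)`. -/
def BouncesForever (μ : ℝ) (u : ℝ → State) : Prop :=
  ∃ t : ℕ → ℝ, StrictMono t ∧ Set.range t = impactTimes ⊤ u ∧ Tendsto t atTop atTop ∧
    (∃ t₀ : ℝ, ∀ s ≥ t₀, (u s).x = 0 → s ∈ impactTimes ⊤ u) ∧
    (fun n => t (n + 1) - t n) ~[atTop] (fun n : ℕ => 3 / μ * (1 / (n : ℝ)))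

end BouncingBall

/-! The velocity `v` of the lower mass jumps at impacts, but `v ^ 2` does not. In `drive` (call it
f) and `driveRate` (call it q) the coefficients of `x` are chosen so that `v` cancels from the
derivatives: the lower mass obeys x'' + μ x' = f + (μ² - 1/2) x with f' = q - μ f + O(x) and q' = -γ
- f/2 + O(x), also across impacts. If f and q both vanish on the floor, then q' = -γ ≠ 0, so the
force never degenerates beyond second order.

No collapse (`eventually_rest_of_frequently`). Suppose that contacts accumulate at T without
eventual rest. Then x and v tend to 0 at T, and f has a definite sign before T. An upward force
would prevent a flight from coming down and would also exclude rest (`false_of_force_pos`). For a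
downward force decaying like (T-t)^m with m = 0, 1, 2, a Gronwall argument bounds an energy of the
lower mass below by c (T-t)^(m+1), whereas `abs_velocity_le` bounds it at contacts by
O((T-t)^(2m+2)), a contradiction (`eventually_rest_of_drive_le`). Hence every motion on a bounded
interval ends in a single mode and has a limit state. After elastic reflection this state can be
continued, the choice between flight and rest being made by the first nonzero one among the force
and its derivatives (`exists_isContinuation`). Zorn's lemma then gives global motions.

Long time behaviour. The total energy decreases at the rate μ (w - v)² and converges, so the damper
does almost nothing on late windows of fixed length (`eventually_window`). Together with boundedness
this forces the stretch, `w`, `x` and finally `v` to tend to 0, and the force to tend to -2γ.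
Eventually `bounceEnergy` dominates v²/2 + γ x and satisfies H' ≤ K H: if it vanishes once, it stays
zero and the lower mass rests; otherwise every late contact is an impact.

Bouncing. A late flight of duration τ is nearly a parabola with acceleration -2γ, so the impact
velocity V is about γ τ and V² drops by about 2 μ γ² τ³ / 3 (`flight_estimate`). Thus 1/V grows by
about μ/(3γ) per impact, and Cesàro averaging gives V ∼ 3γ/(μ n), that is, τ ∼ 3/(μ n)
(`isEquivalent_of_tendsto`). -/

namespace BouncingBall

/-! ### Functions with a right derivative -/

/-- `g` is continuous on `s` and has the right derivative `g'` at every point of `s`. -/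
def HasRightDerivOn (g g' : ℝ → ℝ) (s : Set ℝ) : Prop :=
  ContinuousOn g s ∧ ∀ t ∈ s, HasDerivWithinAt g (g' t) (Ici t) t

namespace HasRightDerivOn

variable {g g' h h' : ℝ → ℝ} {s : Set ℝ}

theorem mono {s' : Set ℝ} (hg : HasRightDerivOn g g' s) (hs : s' ⊆ s) :
    HasRightDerivOn g g' s' :=
  ⟨hg.1.mono hs, fun t ht => hg.2 t (hs ht)⟩

theorem congr_deriv {k : ℝ → ℝ} (hg : HasRightDerivOn g g' s) (hk : ∀ t ∈ s, g' t = k t) :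
    HasRightDerivOn g k s :=
  ⟨hg.1, fun t ht => hk t ht ▸ hg.2 t ht⟩

theorem of_hasDerivAt (hg : ∀ t ∈ s, HasDerivAt g (g' t) t) : HasRightDerivOn g g' s :=
  ⟨fun t ht => (hg t ht).continuousAt.continuousWithinAt, fun t ht => (hg t ht).hasDerivWithinAt⟩

theorem const (c : ℝ) : HasRightDerivOn (fun _ => c) (fun _ => 0) s :=
  of_hasDerivAt fun t _ => hasDerivAt_const t c

theorem id : HasRightDerivOn (fun t => t) (fun _ => 1) s :=
  of_hasDerivAt fun t _ => hasDerivAt_id t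

theorem add (hg : HasRightDerivOn g g' s) (hh : HasRightDerivOn h h' s) :
    HasRightDerivOn (fun t => g t + h t) (fun t => g' t + h' t) s :=
  ⟨hg.1.add hh.1, fun t ht => (hg.2 t ht).add (hh.2 t ht)⟩

theorem sub (hg : HasRightDerivOn g g' s) (hh : HasRightDerivOn h h' s) :
    HasRightDerivOn (fun t => g t - h t) (fun t => g' t - h' t) s :=
  ⟨hg.1.sub hh.1, fun t ht => (hg.2 t ht).sub (hh.2 t ht)⟩

theorem mul (hg : HasRightDerivOn g g' s) (hh : HasRightDerivOn h h' s) :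
    HasRightDerivOn (fun t => g t * h t) (fun t => g' t * h t + g t * h' t) s :=
  ⟨hg.1.mul hh.1, fun t ht => (hg.2 t ht).mul (hh.2 t ht)⟩

theorem const_mul (c : ℝ) (hg : HasRightDerivOn g g' s) :
    HasRightDerivOn (fun t => c * g t) (fun t => c * g' t) s :=
  ⟨hg.1.const_mul c, fun t ht => (hg.2 t ht).const_mul c⟩

theorem sub_le_sub {a b : ℝ} (hg : HasRightDerivOn g g' s) (hh : HasRightDerivOn h h' s)
    (hab : a ≤ b) (hs : Icc a b ⊆ s) (hle : ∀ t ∈ Ico a b, g' t ≤ h' t) :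
    g b - g a ≤ h b - h a := by
  have := image_le_of_deriv_right_le_deriv_boundary (f := g) (f' := g')
    (B := fun t => h t - h a + g a) (B' := h') (hg.1.mono hs)
    (fun t ht => hg.2 t (hs (Ico_subset_Icc_self ht))) (by simp)
    (((hh.1.mono hs).sub continuousOn_const).add continuousOn_const)
    (fun t ht => ((hh.2 t (hs (Ico_subset_Icc_self ht))).sub_const _).add_const _) hle
    (right_mem_Icc.2 hab)
  linarith

theorem le_of_nonpos {a b : ℝ} (hg : HasRightDerivOn g g' s)
    (hab : a ≤ b) (hs : Icc a b ⊆ s) (hle : ∀ t ∈ Ico a b, g' t ≤ 0) : g b ≤ g a := by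
  have := hg.sub_le_sub (const 0) hab hs hle
  linarith

theorem le_of_nonneg {a b : ℝ} (hg : HasRightDerivOn g g' s)
    (hab : a ≤ b) (hs : Icc a b ⊆ s) (hle : ∀ t ∈ Ico a b, 0 ≤ g' t) : g a ≤ g b := by
  have := (const 0).sub_le_sub hg hab hs hle
  linarith

theorem sub_le_mul {a b c : ℝ} (hg : HasRightDerivOn g g' s)
    (hab : a ≤ b) (hs : Icc a b ⊆ s) (hle : ∀ t ∈ Ico a b, g' t ≤ c) :
    g b - g a ≤ c * (b - a) := by
  have := hg.sub_le_sub (id.const_mul c) hab hs (fun t ht => by simpa using hle t ht)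
  linarith

theorem mul_le_sub {a b c : ℝ} (hg : HasRightDerivOn g g' s)
    (hab : a ≤ b) (hs : Icc a b ⊆ s) (hle : ∀ t ∈ Ico a b, c ≤ g' t) :
    c * (b - a) ≤ g b - g a := by
  have := (id.const_mul c).sub_le_sub hg hab hs (fun t ht => by simpa using hle t ht)
  linarith

theorem abs_sub_le {a b c : ℝ} (hg : HasRightDerivOn g g' s)
    (hab : a ≤ b) (hs : Icc a b ⊆ s) (hle : ∀ t ∈ Ico a b, |g' t| ≤ c) :
    |g b - g a| ≤ c * (b - a) := by
  refine abs_le.2 ⟨?_, hg.sub_le_mul hab hs fun t ht => (abs_le.1 (hle t ht)).2⟩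
  have := hg.mul_le_sub hab hs fun t ht => (abs_le.1 (hle t ht)).1
  linarith

end HasRightDerivOn

/-! ### Time domains -/

section timeDomain

variable {T : EReal} {t : ℝ}

theorem timeDomain_top : timeDomain ⊤ = Ici 0 := by
  ext t; simp [timeDomain, EReal.coe_lt_top]

theorem timeDomain_coe (T : ℝ) : timeDomain (T : EReal) = Ico 0 T := by
  ext t; simp [timeDomain]

theorem timeDomain_mono {T' : EReal} (h : T ≤ T') : timeDomain T ⊆ timeDomain T' :=
  fun _ ht => ⟨ht.1, ht.2.trans_le h⟩

theorem Icc_subset_timeDomain {a : ℝ} (ha : 0 ≤ a) (ht : t ∈ timeDomain T) :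
    Icc a t ⊆ timeDomain T :=
  fun _ hs => ⟨ha.trans hs.1, (EReal.coe_le_coe_iff.2 hs.2).trans_lt ht.2⟩

theorem timeDomain_mem_nhdsWithin (ht : t ∈ timeDomain T) : timeDomain T ∈ 𝓝[Ici 0] t := by
  have h : {s : ℝ | (s : EReal) < T} ∈ 𝓝 t :=
    (isOpen_lt continuous_coe_real_ereal continuous_const).mem_nhds ht.2
  filter_upwards [mem_nhdsWithin_of_mem_nhds h, self_mem_nhdsWithin] with s h1 h2 using ⟨h2, h1⟩

theorem nhdsWithin_timeDomain (ht : t ∈ timeDomain T) : 𝓝[timeDomain T] t = 𝓝[Ici 0] t := by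
  refine le_antisymm (nhdsWithin_mono _ fun s hs => hs.1) ?_
  exact nhdsWithin_le_iff.2 (timeDomain_mem_nhdsWithin ht)

theorem timeDomain_mem_nhds (ht : t ∈ timeDomain T) (h0 : 0 < t) : timeDomain T ∈ 𝓝 t := by
  have := timeDomain_mem_nhdsWithin ht
  rwa [nhdsWithin_eq_nhds.2 (Ici_mem_nhds h0)] at this

theorem timeDomain_mem_nhdsGT (ht : t ∈ timeDomain T) : timeDomain T ∈ 𝓝[>] t :=
  nhdsWithin_mono t (fun _ (h : t < _) => ht.1.trans h.le) (timeDomain_mem_nhdsWithin ht)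

theorem timeDomain_mem_nhdsGE (ht : t ∈ timeDomain T) : timeDomain T ∈ 𝓝[≥] t :=
  nhdsWithin_mono t (fun _ (h : t ≤ _) => ht.1.trans h) (timeDomain_mem_nhdsWithin ht)

end timeDomain

/-! ### Coordinates adapted to the equilibrium -/

/-- Elongation of the spring, measured from its value at equilibrium. -/
noncomputable def stretch (γ : ℝ) (s : State) : ℝ := s.y - s.x - 1 + 2 * γ

/-- Energy, measured from its value at equilibrium. -/
noncomputable def energy (γ : ℝ) (s : State) : ℝ :=
  s.v ^ 2 / 2 + s.w ^ 2 / 2 + 2 * γ * s.x + stretch γ s ^ 2 / 4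

/-- The part of the force on the lower mass that is continuously differentiable in time, also
across impacts. -/
noncomputable def drive (μ γ : ℝ) (s : State) : ℝ := floorForce μ γ s - μ ^ 2 * s.x

/-- The derivative of `drive`, up to multiples of `drive` and the height. -/
noncomputable def driveRate (μ γ : ℝ) (s : State) : ℝ := s.w / 2 - 2 * μ * γ - μ * s.x / 2

section coordinates

variable (μ γ : ℝ) (s : State)

theorem lowerAcc_eq_stretch :
    lowerAcc μ γ s = -2 * γ + stretch γ s / 2 + μ * (s.w - s.v) := by
  simp only [lowerAcc, stretch]; ring

theorem upperAcc_eq_stretch : upperAcc μ γ s = -(stretch γ s / 2) - μ * (s.w - s.v) := by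
  simp only [upperAcc, stretch]; ring

theorem lowerAcc_eq_drive :
    lowerAcc μ γ s = drive μ γ s + (μ ^ 2 - 1 / 2) * s.x - μ * s.v := by
  simp only [lowerAcc, drive, floorForce]; ring

theorem drive_eq_stretch :
    drive μ γ s = -2 * γ + stretch γ s / 2 + μ * s.w - (μ ^ 2 - 1 / 2) * s.x := by
  simp only [drive, floorForce, stretch]; ring

end coordinates

/-! ### Basic consequences of the equations of motion -/

namespace IsMotion

variable {μ γ : ℝ} {T : EReal} {u : ℝ → State}

theorem velocity_eq_zero_of_eventually (h : IsMotion μ γ T u) {t : ℝ} (ht : t ∈ timeDomain T)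
    (h0 : (u t).x = 0) (hx : ∀ᶠ s in 𝓝[>] t, (u s).x = 0) : (u t).v = 0 := by
  have h1 := h.right_deriv_x t ht
  have h2 : HasDerivWithinAt (fun s => (u s).x) 0 (Ioi t) t :=
    (hasDerivWithinAt_const t (Ioi t) (0 : ℝ)).congr_of_eventuallyEq hx h0
  exact (uniqueDiffWithinAt_Ioi t).eq_deriv _ h1 h2

theorem tendsto_x_right (h : IsMotion μ γ T u) {t : ℝ} (ht : t ∈ timeDomain T) :
    Tendsto (fun s => (u s).x) (𝓝[>] t) (𝓝 (u t).x) :=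
  (h.right_deriv_x t ht).continuousWithinAt

theorem right_deriv_y (h : IsMotion μ γ T u) {t : ℝ} (ht : t ∈ timeDomain T) :
    HasDerivWithinAt (fun s => (u s).y) (u t).w (Ici t) t :=
  (h.deriv_y t ht).mono_of_mem_nhdsWithin (timeDomain_mem_nhdsGE ht)

theorem tendsto_y_right (h : IsMotion μ γ T u) {t : ℝ} (ht : t ∈ timeDomain T) :
    Tendsto (fun s => (u s).y) (𝓝[>] t) (𝓝 (u t).y) :=
  (h.right_deriv_y ht).continuousWithinAt.tendsto.mono_left (nhdsWithin_mono _ Ioi_subset_Ici_self)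

theorem tendsto_w_right (h : IsMotion μ γ T u) {t : ℝ} (ht : t ∈ timeDomain T) :
    Tendsto (fun s => (u s).w) (𝓝[>] t) (𝓝 (u t).w) :=
  (h.cont_w t ht).tendsto.mono_left (nhdsWithin_le_iff.2 (timeDomain_mem_nhdsGT ht))

theorem tendsto_lowerAcc_right (h : IsMotion μ γ T u) {t : ℝ} (ht : t ∈ timeDomain T) :
    Tendsto (fun s => lowerAcc μ γ (u s)) (𝓝[>] t) (𝓝 (lowerAcc μ γ (u t))) :=
  ((((h.tendsto_y_right ht).div_const 2).const_add _).add
    ((h.tendsto_w_right ht).const_mul μ) |>.sub ((h.right_cont_v t ht).const_mul μ)).sub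
    ((h.tendsto_x_right ht).div_const 2)

theorem tendsto_upperAcc_right (h : IsMotion μ γ T u) {t : ℝ} (ht : t ∈ timeDomain T) :
    Tendsto (fun s => upperAcc μ γ (u s)) (𝓝[>] t) (𝓝 (upperAcc μ γ (u t))) :=
  ((((h.tendsto_x_right ht).div_const 2).const_add _).add
    ((h.right_cont_v t ht).const_mul μ) |>.sub ((h.tendsto_w_right ht).const_mul μ)).sub
    ((h.tendsto_y_right ht).div_const 2)

/-- Just after `t`, the times are positive and belong to the domain. -/
theorem _root_.BouncingBall.eventually_timeDomain_right {t : ℝ} (ht : t ∈ timeDomain T) :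
    ∀ᶠ s in 𝓝[>] t, s ∈ timeDomain T ∧ 0 < s := by
  filter_upwards [timeDomain_mem_nhdsGT ht, self_mem_nhdsWithin] with s h1 h2
  exact ⟨h1, ht.1.trans_lt h2⟩

/-- If `P` holds just after `t`, then it does so in a neighbourhood of each time just after `t`. -/
theorem _root_.BouncingBall.eventually_eventually_right {t : ℝ} {P : ℝ → Prop}
    (h : ∀ᶠ s in 𝓝[>] t, P s) : ∀ᶠ s in 𝓝[>] t, ∀ᶠ r in 𝓝 s, P r := by
  obtain ⟨b, hb, hP⟩ := mem_nhdsGT_iff_exists_Ioo_subset.1 h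
  filter_upwards [Ioo_mem_nhdsGT hb] with s hs
  filter_upwards [Ioo_mem_nhds hs.1 hs.2] with r hr using hP hr

/-- This carries the equations of motion over to impact times, as right derivatives, from the limits
of the derivatives just afterwards. -/
theorem _root_.BouncingBall.hasDerivWithinAt_of_eventually {g g' : ℝ → ℝ} {t : ℝ} (hg : Tendsto g (𝓝[>] t) (𝓝 (g t)))
    (hg' : Tendsto g' (𝓝[>] t) (𝓝 (g' t))) (h : ∀ᶠ s in 𝓝[>] t, HasDerivAt g (g' s) s) :
    HasDerivWithinAt g (g' t) (Ici t) t := by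
  refine hasDerivWithinAt_Ici_of_tendsto_deriv (s := {s | HasDerivAt g (g' s) s} ∩ Ioi t)
    (fun s hs => hs.1.differentiableAt.differentiableWithinAt) ?_
    (inter_mem h self_mem_nhdsWithin) (hg'.congr' ?_)
  · exact hg.mono_left (nhdsWithin_mono _ inter_subset_right)
  · filter_upwards [h] with s hs using hs.deriv.symm

theorem right_deriv_w (h : IsMotion μ γ T u) {t : ℝ} (ht : t ∈ timeDomain T) :
    HasDerivWithinAt (fun s => (u s).w) (upperAcc μ γ (u t)) (Ici t) t := by
  refine hasDerivWithinAt_of_eventually (g' := fun s => upperAcc μ γ (u s)) (h.tendsto_w_right ht)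
    (h.tendsto_upperAcc_right ht) ?_
  rcases h.mode_right t ht with hx | hx
  · filter_upwards [hx, eventually_timeDomain_right ht] with s hs hd
    exact (h.flight s hd.1 hd.2 hs).2.2
  · filter_upwards [eventually_eventually_right hx, eventually_timeDomain_right ht] with s hs hd
    exact (h.contact s hd.1 hd.2 hs).1

theorem right_deriv_v (h : IsMotion μ γ T u) {t : ℝ} (ht : t ∈ timeDomain T)
    (hx : ∀ᶠ s in 𝓝[>] t, 0 < (u s).x) :
    HasDerivWithinAt (fun s => (u s).v) (lowerAcc μ γ (u t)) (Ici t) t := by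
  refine hasDerivWithinAt_of_eventually (g' := fun s => lowerAcc μ γ (u s)) (h.right_cont_v t ht)
    (h.tendsto_lowerAcc_right ht) ?_
  filter_upwards [hx, eventually_timeDomain_right ht] with s hs hd
  exact (h.flight s hd.1 hd.2 hs).2.1

theorem x_eq_zero_of_eventually (h : IsMotion μ γ T u) {t : ℝ} (ht : t ∈ timeDomain T)
    (hx : ∀ᶠ s in 𝓝[>] t, (u s).x = 0) : (u t).x = 0 :=
  tendsto_nhds_unique (h.tendsto_x_right ht)
    (tendsto_const_nhds.congr' (hx.mono fun _ hs => hs.symm))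

/-- An elastic impact only changes the sign of `v`, so the square has equal one-sided limits. -/
theorem cont_sq_v (h : IsMotion μ γ T u) :
    ContinuousOn (fun t => (u t).v ^ 2 / 2) (timeDomain T) := by
  intro t ht
  rcases ht.1.eq_or_lt with h0 | h0
  · subst h0
    have h1 : ContinuousWithinAt (fun t => (u t).v) (Ioi 0) 0 := h.right_cont_v 0 ht
    have h2 := continuousWithinAt_Ioi_iff_Ici.1 h1
    exact ((h2.mono fun s hs => hs.1).pow 2).div_const 2
  · refine ContinuousAt.continuousWithinAt ?_
    rcases (h.nonneg t ht).eq_or_lt with hx | hx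
    · refine continuousAt_iff_continuous_left'_right'.2 ⟨?_, ?_⟩
      · have := ((h.impact t ht h0 hx.symm).pow 2).div_const 2
        rwa [neg_sq] at this
      · exact ((h.right_cont_v t ht).pow 2).div_const 2
    · exact ((h.flight t ht h0 hx).2.1.continuousAt.pow 2).div_const 2

theorem hasRightDerivOn_x (h : IsMotion μ γ T u) :
    HasRightDerivOn (fun t => (u t).x) (fun t => (u t).v) (timeDomain T) :=
  ⟨h.cont_x, fun t ht => hasDerivWithinAt_Ioi_iff_Ici.1 (h.right_deriv_x t ht)⟩

theorem hasRightDerivOn_y (h : IsMotion μ γ T u) :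
    HasRightDerivOn (fun t => (u t).y) (fun t => (u t).w) (timeDomain T) :=
  ⟨fun t ht => (h.deriv_y t ht).continuousWithinAt, fun _ ht => h.right_deriv_y ht⟩

theorem hasRightDerivOn_w (h : IsMotion μ γ T u) :
    HasRightDerivOn (fun t => (u t).w) (fun t => upperAcc μ γ (u t)) (timeDomain T) :=
  ⟨h.cont_w, fun _ ht => h.right_deriv_w ht⟩

/-- During rest `v` vanishes, so the formula holds although `lowerAcc` then differs from the actual
acceleration zero. -/
theorem hasRightDerivOn_sq_v (h : IsMotion μ γ T u) :
    HasRightDerivOn (fun t => (u t).v ^ 2 / 2) (fun t => (u t).v * lowerAcc μ γ (u t))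
      (timeDomain T) := by
  refine ⟨h.cont_sq_v, fun t ht => ?_⟩
  rcases h.mode_right t ht with hx | hx
  · have := ((h.right_deriv_v ht hx).pow 2).div_const 2
    refine this.congr_deriv ?_
    simp; ring
  · have h0 := h.velocity_eq_zero_of_eventually ht (h.x_eq_zero_of_eventually ht hx) hx
    simp only [h0, zero_mul]
    have h1 : ∀ᶠ s in 𝓝[>] t, (u s).v ^ 2 / 2 = 0 := by
      filter_upwards [hx, eventually_eventually_right hx, eventually_timeDomain_right ht]
        with s h1 h2 h3
      rw [h.velocity_eq_zero_of_eventually h3.1 h1 (h2.filter_mono nhdsWithin_le_nhds)]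
      norm_num
    refine hasDerivWithinAt_Ioi_iff_Ici.1 ?_
    exact (hasDerivWithinAt_const t (Ioi t) (0 : ℝ)).congr_of_eventuallyEq h1 (by simp [h0])

theorem hasRightDerivOn_stretch (h : IsMotion μ γ T u) :
    HasRightDerivOn (fun t => stretch γ (u t)) (fun t => (u t).w - (u t).v) (timeDomain T) :=
  (((h.hasRightDerivOn_y.sub h.hasRightDerivOn_x).sub (.const 1)).add
    (.const (2 * γ))).congr_deriv fun t _ => by ring

/-- Gravity and the spring are conservative and the floor does no work; only the damper dissipates.
-/
theorem hasRightDerivOn_energy (h : IsMotion μ γ T u) :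
    HasRightDerivOn (fun t => energy γ (u t)) (fun t => -μ * ((u t).w - (u t).v) ^ 2)
      (timeDomain T) := by
  have h1 := ((h.hasRightDerivOn_sq_v.add
    ((h.hasRightDerivOn_w.mul h.hasRightDerivOn_w).const_mul (1 / 2))).add
    (h.hasRightDerivOn_x.const_mul (2 * γ))).add
    ((h.hasRightDerivOn_stretch.mul h.hasRightDerivOn_stretch).const_mul (1 / 4))
  have h2 := h1.congr_deriv (k := fun t => -μ * ((u t).w - (u t).v) ^ 2) fun t _ => by
    simp only [lowerAcc_eq_stretch, upperAcc_eq_stretch]; ring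
  convert h2 using 2 with t
  simp only [energy]; ring

/-- The term μ² v coming from μ w' cancels against the derivative of μ² x. The result is free of
`v`, hence continuous across impacts. -/
theorem hasRightDerivOn_drive (h : IsMotion μ γ T u) :
    HasRightDerivOn (fun t => drive μ γ (u t))
      (fun t => driveRate μ γ (u t) - μ * drive μ γ (u t) + (μ - μ ^ 3) * (u t).x)
      (timeDomain T) := by
  have h1 := (((h.hasRightDerivOn_stretch.const_mul (1 / 2)).add (.const (-2 * γ))).add
    (h.hasRightDerivOn_w.const_mul μ)).sub (h.hasRightDerivOn_x.const_mul (μ ^ 2 - 1 / 2))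
  have h2 := h1.congr_deriv (k := fun t => driveRate μ γ (u t) - μ * drive μ γ (u t)
      + (μ - μ ^ 3) * (u t).x) fun t _ => by
    simp only [drive_eq_stretch, upperAcc_eq_stretch, driveRate]; ring
  convert h2 using 2 with t
  simp only [drive_eq_stretch]; ring

/-- Here μ v / 2 cancels in the same way. The constant -γ makes the second-order degeneracy of the
force the worst possible one. -/
theorem hasRightDerivOn_driveRate (h : IsMotion μ γ T u) :
    HasRightDerivOn (fun t => driveRate μ γ (u t))
      (fun t => -γ - drive μ γ (u t) / 2 - (μ ^ 2 - 1 / 2) / 2 * (u t).x) (timeDomain T) := by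
  have h1 := ((h.hasRightDerivOn_w.const_mul (1 / 2)).sub (.const (2 * μ * γ))).sub
    (h.hasRightDerivOn_x.const_mul (μ / 2))
  have h2 := h1.congr_deriv (k := fun t => -γ - drive μ γ (u t) / 2
      - (μ ^ 2 - 1 / 2) / 2 * (u t).x) fun t _ => by
    simp only [drive_eq_stretch, upperAcc_eq_stretch]; ring
  convert h2 using 2 with t
  simp only [driveRate]; ring

theorem energy_antitone (h : IsMotion μ γ T u) (hμ : 0 < μ) {s t : ℝ} (hs : 0 ≤ s) (hst : s ≤ t)
    (ht : t ∈ timeDomain T) : energy γ (u t) ≤ energy γ (u s) :=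
  h.hasRightDerivOn_energy.le_of_nonpos hst (Icc_subset_timeDomain hs ht) fun r _ => by
    nlinarith [sq_nonneg ((u r).w - (u r).v)]

/-- All coordinates stay bounded. -/
theorem exists_bound (h : IsMotion μ γ T u) (hμ : 0 < μ) (hγ : 0 < γ) :
    ∃ C > 0, ∀ t ∈ timeDomain T, |(u t).v| ≤ C ∧ |(u t).w| ≤ C ∧ (u t).x ≤ C ∧
      |stretch γ (u t)| ≤ C ∧ |lowerAcc μ γ (u t)| ≤ C ∧ |upperAcc μ γ (u t)| ≤ C := by
  set N := energy γ (u 0)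
  -- Each square in the energy is at most a multiple of N, and 2 N ≤ (2 N + 1)², 4 N ≤ (4 N + 1)²
  -- because N is nonnegative.
  have key : ∀ t ∈ timeDomain T, |(u t).v| ≤ 2 * N + 1 ∧ |(u t).w| ≤ 2 * N + 1 ∧
      2 * γ * (u t).x ≤ N ∧ |stretch γ (u t)| ≤ 4 * N + 1 := by
    intro t ht
    have h1 : energy γ (u t) ≤ N := h.energy_antitone hμ le_rfl ht.1 ht
    have h2 : 0 ≤ 2 * γ * (u t).x := by have := h.nonneg t ht; positivity
    simp only [energy] at h1
    refine ⟨abs_le_of_sq_le_sq ?_ ?_, abs_le_of_sq_le_sq ?_ ?_, ?_, abs_le_of_sq_le_sq ?_ ?_⟩ <;>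
    nlinarith [sq_nonneg (u t).v, sq_nonneg (u t).w, sq_nonneg (stretch γ (u t)), sq_nonneg N]
  set B := 4 * N ^ 2 + 4 * |N| + 1 + |N| / (2 * γ)
  have hB : 0 < B := by positivity
  refine ⟨B + (2 * γ + B / 2 + μ * (2 * B)), by positivity, fun t ht => ?_⟩
  obtain ⟨k1, k2, k3, k4⟩ := key t ht
  have e1 : 0 ≤ |N| / (2 * γ) := by positivity
  have hN := le_abs_self N
  have hN' := abs_nonneg N
  have hv : |(u t).v| ≤ B := by simp only [B]; nlinarith
  have hw : |(u t).w| ≤ B := by simp only [B]; nlinarith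
  have hp : |stretch γ (u t)| ≤ B := by simp only [B]; nlinarith
  have hx : (u t).x ≤ B := by
    have : (u t).x ≤ |N| / (2 * γ) := by
      rw [le_div_iff₀ (by positivity)]; linarith
    simp only [B]; nlinarith
  have hr : |μ * ((u t).w - (u t).v)| ≤ μ * (2 * B) := by
    rw [abs_mul, abs_of_pos hμ]
    have := abs_sub (u t).w (u t).v
    gcongr; linarith
  have e2 : 0 < μ * (2 * B) := by positivity
  refine ⟨by linarith, by linarith, by linarith, by linarith, ?_, ?_⟩
  · rw [lowerAcc_eq_stretch]
    rw [abs_le] at hr hp ⊢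
    constructor <;> linarith
  · rw [upperAcc_eq_stretch]
    rw [abs_le] at hr hp ⊢
    constructor <;> linarith

end IsMotion

/-! ### A priori estimates when contacts accumulate -/

/-- A nonnegative continuous function is positive on a maximal interval around each point between
two zeros at which it does not vanish. -/
theorem exists_excursion {g : ℝ → ℝ} {c d t : ℝ} (hg : ContinuousOn g (Icc c d))
    (h0 : ∀ s ∈ Icc c d, 0 ≤ g s) (hc : g c = 0) (hd : g d = 0) (ht : t ∈ Icc c d)
    (hpos : 0 < g t) :
    ∃ a b, c ≤ a ∧ a < t ∧ t < b ∧ b ≤ d ∧ g a = 0 ∧ g b = 0 ∧ ∀ s ∈ Ioo a b, 0 < g s := by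
  have hZ : ∀ p q, Icc p q ⊆ Icc c d → IsCompact {s ∈ Icc p q | g s = 0} := fun p q hpq =>
    ((hg.mono hpq).preimage_isClosed_of_isClosed isClosed_Icc
      (isClosed_singleton (x := (0 : ℝ)))) |> isCompact_Icc.of_isClosed_subset <| fun s hs => hs.1
  have hl : Icc c t ⊆ Icc c d := Icc_subset_Icc_right ht.2
  have hr : Icc t d ⊆ Icc c d := Icc_subset_Icc_left ht.1
  obtain ⟨a, ⟨ha, ga⟩, hamax⟩ := (hZ c t hl).exists_isGreatest ⟨c, left_mem_Icc.2 ht.1, hc⟩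
  obtain ⟨b, ⟨hb, gb⟩, hbmin⟩ := (hZ t d hr).exists_isLeast ⟨d, right_mem_Icc.2 ht.2, hd⟩
  have hat : a ≠ t := by rintro rfl; exact hpos.ne' ga
  have htb : t ≠ b := by rintro rfl; exact hpos.ne' gb
  refine ⟨a, b, ha.1, lt_of_le_of_ne ha.2 hat, lt_of_le_of_ne hb.1 htb, hb.2, ga, gb, ?_⟩
  intro s hs
  refine lt_of_le_of_ne (h0 s ⟨ha.1.trans hs.1.le, hs.2.le.trans hb.2⟩) fun h => ?_
  rcases le_total s t with hst | hst
  · exact (hamax ⟨⟨ha.1.trans hs.1.le, hst⟩, h.symm⟩).not_gt hs.1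
  · exact (hbmin ⟨⟨hst, hs.2.le.trans hb.2⟩, h.symm⟩).not_gt hs.2

namespace IsMotion

variable {μ γ : ℝ} {T : EReal} {u : ℝ → State}

/-- The interval contains `a`, where `v` is the velocity after the impact, but not `b`, where `v`
may jump. -/
theorem hasRightDerivOn_v (h : IsMotion μ γ T u) {a b : ℝ} (ha : 0 ≤ a)
    (hT : Ico a b ⊆ timeDomain T) (hx : ∀ s ∈ Ioo a b, 0 < (u s).x) :
    HasRightDerivOn (fun t => (u t).v) (fun t => lowerAcc μ γ (u t)) (Ico a b) := by
  constructor
  · intro t ht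
    rcases ht.1.eq_or_lt with h0 | h0
    · subst h0
      have h1 : ContinuousWithinAt (fun t => (u t).v) (Ioi a) a := h.right_cont_v a (hT ht)
      exact (continuousWithinAt_Ioi_iff_Ici.1 h1).mono Ico_subset_Ici_self
    · exact (h.flight t (hT ht) (ha.trans_lt h0)
        (hx t ⟨h0, ht.2⟩)).2.1.continuousAt.continuousWithinAt
  · intro t ht
    refine h.right_deriv_v (hT ht) ?_
    filter_upwards [Ioo_mem_nhdsGT ht.2] with s hs using hx s ⟨ht.1.trans_lt hs.1, hs.2⟩

theorem velocity_nonneg (h : IsMotion μ γ T u) {t : ℝ} (ht : t ∈ timeDomain T)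
    (hx : (u t).x = 0) : 0 ≤ (u t).v := by
  have h1 := (hasDerivWithinAt_iff_tendsto_slope' (by simp)).1 (h.right_deriv_x t ht)
  refine ge_of_tendsto h1 ?_
  filter_upwards [eventually_timeDomain_right ht, self_mem_nhdsWithin] with s hs hst
  rw [slope_def_field, hx, sub_zero]
  exact div_nonneg (h.nonneg s hs.1) (sub_nonneg.2 (le_of_lt hst))

/-- In each flight the velocity of the lower mass vanishes somewhere. -/
theorem exists_velocity_eq_zero (h : IsMotion μ γ T u) {a b : ℝ} (ha : 0 ≤ a) (hab : a < b)
    (hT : b ∈ timeDomain T) (hxa : (u a).x = 0) (hxb : (u b).x = 0)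
    (hx : ∀ s ∈ Ioo a b, 0 < (u s).x) : ∃ s ∈ Ioo a b, (u s).v = 0 :=
  exists_hasDerivAt_eq_zero hab (h.cont_x.mono (Icc_subset_timeDomain ha hT)) (hxa.trans hxb.symm)
    fun s hs => (h.flight s (Icc_subset_timeDomain ha hT (Ioo_subset_Icc_self hs))
      (ha.trans_lt hs.1) (hx s hs)).1

section collapse

variable {T : ℝ}

/-- If contacts accumulate at `T`, then after a contact shortly before `T` the velocity is
controlled by the driving force and the time that remains. -/
theorem abs_velocity_le (h : IsMotion μ γ T u) (hμ : 0 < μ) (hγ : 0 < γ) {c B : ℝ} (hc : 0 ≤ c)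
    (hcT : c < T) (hxc : (u c).x = 0) (hfreq : ∀ t < T, ∃ s ∈ Ioo t T, (u s).x = 0)
    (hB : ∀ t ∈ Ico c T, |drive μ γ (u t)| ≤ B)
    (hD : (|μ ^ 2 - 1 / 2| * (T - c) + μ) * (T - c) ≤ 1 / 2) :
    ∀ t ∈ Ico c T, |(u t).v| ≤ 2 * B * (T - c) := by
  obtain ⟨C, hC, hbd⟩ := h.exists_bound hμ hγ
  have hsub : Ico c T ⊆ timeDomain T := by
    rw [timeDomain_coe]; exact Ico_subset_Ico_left hc
  set D := T - c with hDdef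
  have hD0 : 0 < D := sub_pos.2 hcT
  set S := (fun t => |(u t).v|) '' Ico c T
  have hSne : S.Nonempty := ⟨_, c, left_mem_Ico.2 hcT, rfl⟩
  have hSb : BddAbove S := ⟨C, by rintro _ ⟨t, ht, rfl⟩; exact (hbd t (hsub ht)).1⟩
  -- The supremum of the speed is bounded in terms of itself, and its own contribution is absorbed
  -- by `hD`.
  set M := sSup S with hM
  have hvM : ∀ t ∈ Ico c T, |(u t).v| ≤ M := fun t ht => le_csSup hSb ⟨t, ht, rfl⟩
  have hM0 : 0 ≤ M := (abs_nonneg _).trans (hvM c (left_mem_Ico.2 hcT))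
  have hB0 : 0 ≤ B := (abs_nonneg _).trans (hB c (left_mem_Ico.2 hcT))
  set K := B + |μ ^ 2 - 1 / 2| * (M * D) + μ * M with hK
  have hK0 : 0 ≤ K := by positivity
  have hxM : ∀ t ∈ Ico c T, |(u t).x| ≤ M * D := by
    intro t ht
    have h1 := h.hasRightDerivOn_x.abs_sub_le (c := M) ht.1 (Icc_subset_timeDomain hc (hsub ht))
      fun s hs => hvM s ⟨hs.1, hs.2.trans ht.2⟩
    rw [hxc, sub_zero] at h1
    exact h1.trans (mul_le_mul_of_nonneg_left (by linarith [ht.2]) hM0)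
  have hacc : ∀ t ∈ Ico c T, |lowerAcc μ γ (u t)| ≤ K := by
    intro t ht
    rw [lowerAcc_eq_drive, sub_eq_add_neg]
    refine (abs_add_three _ _ _).trans ?_
    rw [abs_neg, abs_mul, abs_mul, abs_of_pos hμ]
    have := hB t ht
    have := mul_le_mul_of_nonneg_left (hxM t ht) (abs_nonneg (μ ^ 2 - 1 / 2))
    have := mul_le_mul_of_nonneg_left (hvM t ht) hμ.le
    linarith
  -- Contacts before and after `t` enclose the flight in an excursion. Its velocity vanishes at some
  -- s, and integrating the acceleration between s and t costs at most K D.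
  have hfl : ∀ t ∈ Ico c T, 0 < (u t).x → |(u t).v| ≤ K * D := by
    intro t ht hxt
    obtain ⟨d, hd, hxd⟩ := hfreq t ht.2
    have hdT : d ∈ timeDomain T := hsub ⟨ht.1.trans hd.1.le, hd.2⟩
    obtain ⟨a, b, hca, hat, htb, hbd, hxa, hxb, hpos⟩ := exists_excursion
      (h.cont_x.mono (Icc_subset_timeDomain hc hdT))
      (fun s hs => h.nonneg s (Icc_subset_timeDomain hc hdT hs)) hxc hxd ⟨ht.1, hd.1.le⟩ hxt
    have hbT : b ∈ timeDomain T := Icc_subset_timeDomain hc hdT ⟨by linarith, hbd⟩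
    obtain ⟨s, hs, hvs⟩ := h.exists_velocity_eq_zero (hc.trans hca) (hat.trans htb) hbT hxa hxb hpos
    have hv := h.hasRightDerivOn_v (hc.trans hca)
      (Ico_subset_Icc_self.trans (Icc_subset_timeDomain (hc.trans hca) hbT)) hpos
    have hIco : ∀ r, a < r → r < b → r ∈ Ico c T := fun r h1 h2 => ⟨by linarith, by linarith [hd.2]⟩
    rcases le_total s t with hst | hst
    · have := hv.abs_sub_le (c := K) hst (fun r hr => ⟨hs.1.le.trans hr.1, hr.2.trans_lt htb⟩)
        fun r hr => hacc r (hIco r (hs.1.trans_le hr.1) (hr.2.trans htb))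
      rw [hvs, sub_zero] at this
      exact this.trans (mul_le_mul_of_nonneg_left (by linarith [ht.2, hs.1]) hK0)
    · have := hv.abs_sub_le (c := K) hst (fun r hr => ⟨hat.le.trans hr.1, hr.2.trans_lt hs.2⟩)
        fun r hr => hacc r (hIco r (hat.trans_le hr.1) (hr.2.trans hs.2))
      rw [hvs, zero_sub, abs_neg] at this
      exact this.trans (mul_le_mul_of_nonneg_left (by linarith [ht.1, hs.2, hd.2]) hK0)
  -- At a time that starts a flight, right continuity carries the bound over; at one that starts a
  -- rest, the velocity is zero.
  have hall : ∀ t ∈ Ico c T, |(u t).v| ≤ K * D := by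
    intro t ht
    rcases h.mode_right t (hsub ht) with hx | hx
    · refine le_of_tendsto (h.right_cont_v t (hsub ht)).abs ?_
      filter_upwards [hx, Ioo_mem_nhdsGT ht.2] with s hs hs'
      exact hfl s ⟨ht.1.trans hs'.1.le, hs'.2⟩ hs
    · rw [h.velocity_eq_zero_of_eventually (hsub ht) (h.x_eq_zero_of_eventually (hsub ht) hx) hx]
      simpa using mul_nonneg hK0 hD0.le
  have hMK : M ≤ K * D := csSup_le hSne (by rintro _ ⟨t, ht, rfl⟩; exact hall t ht)
  -- By `hD` the part of K D proportional to M is at most M / 2, which leaves M ≤ 2 B D.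
  have h1 : K * D = B * D + M * ((|μ ^ 2 - 1 / 2| * D + μ) * D) := by rw [hK]; ring
  have h2 := mul_le_mul_of_nonneg_left hD hM0
  intro t ht
  have := hvM t ht
  linarith

/-- Contacts cannot accumulate at `T` if the force on the lower mass points upwards before `T`. -/
theorem false_of_force_pos (h : IsMotion μ γ T u) (hT : 0 < T)
    (hfreq : ∀ t < T, ∃ s ∈ Ioo t T, (u s).x = 0)
    (hf : ∀ᶠ t in 𝓝[<] T, 0 < drive μ γ (u t) + (μ ^ 2 - 1 / 2) * (u t).x) : False := by
  obtain ⟨b, hb, hf⟩ := mem_nhdsLT_iff_exists_Ioo_subset.1 hf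
  obtain ⟨c, hc, hxc⟩ := hfreq (max b 0) (max_lt hb hT)
  have hbc : b < c := (le_max_left _ _).trans_lt hc.1
  have hc0 : 0 < c := (le_max_right _ _).trans_lt hc.1
  have hdom : ∀ {t}, c ≤ t → t < T → t ∈ timeDomain T := fun h1 h2 => by
    rw [timeDomain_coe]; exact ⟨hc0.le.trans h1, h2⟩
  have hcT := hdom le_rfl hc.2
  rcases h.mode_right c hcT with hx | hx
  · obtain ⟨e, he, hxe⟩ := mem_nhdsGT_iff_exists_Ioo_subset.1 hx
    have he' : c < min e T := lt_min he hc.2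
    obtain ⟨t, ht⟩ := exists_between he'
    have hxt : 0 < (u t).x := hxe ⟨ht.1, ht.2.trans_le (min_le_left _ _)⟩
    have htT : t < T := ht.2.trans_le (min_le_right _ _)
    obtain ⟨d, hd, hxd⟩ := hfreq t htT
    have hdT := hdom (ht.1.trans hd.1).le hd.2
    obtain ⟨a, b', hca, hat, htb, hbd, hxa, hxb, hpos⟩ := exists_excursion
      (h.cont_x.mono (Icc_subset_timeDomain hc0.le hdT))
      (fun s hs => h.nonneg s (Icc_subset_timeDomain hc0.le hdT hs)) hxc hxd
      ⟨ht.1.le, hd.1.le⟩ hxt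
    have ha0 : 0 ≤ a := hc0.le.trans hca
    have hbT := hdom (hca.trans (hat.trans htb).le) (hbd.trans_lt hd.2)
    have hab := hat.trans htb
    have hv0 := h.velocity_nonneg (hdom hca (by linarith)) hxa
    have hIco : Ico a b' ⊆ timeDomain T := Ico_subset_Icc_self.trans (Icc_subset_timeDomain ha0 hbT)
    have hv := h.hasRightDerivOn_v ha0 hIco hpos
    -- The integrating factor exp(μ t) removes the friction term. An upward force then keeps the
    -- velocity nonnegative throughout the flight, so the height cannot return to zero.
    have hexp : HasRightDerivOn (fun t => Real.exp (μ * t))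
        (fun t => Real.exp (μ * t) * μ) (Ico a b') :=
      .of_hasDerivAt fun t _ => by simpa using ((hasDerivAt_id t).const_mul μ).exp
    have hvpos : ∀ r ∈ Ico a b', 0 ≤ (u r).v := by
      intro r hr
      have h3 := (hexp.mul hv).le_of_nonneg hr.1 (fun q hq => ⟨hq.1, hq.2.trans_lt hr.2⟩)
        fun q hq => by
          have h1 : 0 < drive μ γ (u q) + (μ ^ 2 - 1 / 2) * (u q).x :=
            hf ⟨by linarith [hq.1], by linarith [hq.2, hr.2, hd.2]⟩
          have h2 := mul_pos (Real.exp_pos (μ * q)) h1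
          rw [lowerAcc_eq_drive]
          nlinarith
      exact nonneg_of_mul_nonneg_right ((mul_nonneg (Real.exp_pos _).le hv0).trans h3)
        (Real.exp_pos _)
    have := h.hasRightDerivOn_x.le_of_nonneg htb.le
      (Icc_subset_timeDomain (ha0.trans hat.le) hbT) fun r hr => hvpos r ⟨hat.le.trans hr.1, hr.2⟩
    linarith
  -- At rest `drive` is the floor force, which the rules require to be nonpositive.
  · have h1 := (eventually_eventually_right hx).and (Ioo_mem_nhdsGT hc.2)
    obtain ⟨s, hs, hs'⟩ := h1.exists
    have h2 := (h.contact s (hdom hs'.1.le hs'.2) (hc0.trans hs'.1) hs).2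
    have h3 : 0 < drive μ γ (u s) + (μ ^ 2 - 1 / 2) * (u s).x := hf ⟨hbc.trans hs'.1, hs'.2⟩
    rw [drive, hs.self_of_nhds] at h3
    linarith

end collapse

end IsMotion

/-! ### One-sided limits at the end of a bounded interval -/

namespace HasRightDerivOn

variable {g g' : ℝ → ℝ} {T : ℝ}

/-- A bounded right derivative makes `g` Lipschitz, and a Lipschitz function extends continuously
beyond T. -/
theorem exists_tendsto {a C : ℝ} (hg : HasRightDerivOn g g' (Ico a T)) (haT : a < T)
    (hC : ∀ t ∈ Ico a T, |g' t| ≤ C) : ∃ l, Tendsto g (𝓝[<] T) (𝓝 l) := by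
  have hC0 : 0 ≤ C := (abs_nonneg _).trans (hC a (left_mem_Ico.2 haT))
  have key : ∀ s ∈ Ico a T, ∀ t ∈ Ico a T, s ≤ t → |g t - g s| ≤ C * (t - s) :=
    fun s hs t ht hst => hg.abs_sub_le hst (fun r hr => ⟨hs.1.trans hr.1, hr.2.trans_lt ht.2⟩)
      fun r hr => hC r ⟨hs.1.trans hr.1, hr.2.trans ht.2⟩
  have hL : LipschitzOnWith ⟨C, hC0⟩ g (Ico a T) := by
    refine LipschitzOnWith.of_dist_le_mul fun s hs t ht => ?_
    simp only [Real.dist_eq]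
    rcases le_total s t with h | h
    · rw [abs_sub_comm, abs_sub_comm s, abs_of_nonneg (sub_nonneg.2 h)]
      exact key s hs t ht h
    · rw [abs_of_nonneg (sub_nonneg.2 h)]
      exact key t ht s hs h
  obtain ⟨k, hk, hEq⟩ := hL.extend_real
  refine ⟨k T, ((hk.continuous.tendsto T).mono_left nhdsWithin_le_nhds).congr' ?_⟩
  filter_upwards [Ioo_mem_nhdsLT haT] with t ht using (hEq ⟨ht.1.le, ht.2⟩).symm

theorem le_limit {a l : ℝ} (hg : HasRightDerivOn g g' (Ico a T)) (haT : a < T)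
    (h0 : ∀ t ∈ Ico a T, 0 ≤ g' t) (hl : Tendsto g (𝓝[<] T) (𝓝 l)) : g a ≤ l := by
  refine ge_of_tendsto hl ?_
  filter_upwards [Ioo_mem_nhdsLT haT] with t ht
  exact hg.le_of_nonneg ht.1.le (fun r hr => ⟨hr.1, hr.2.trans_lt ht.2⟩)
    fun r hr => h0 r ⟨hr.1, hr.2.trans ht.2⟩

theorem mul_le_limit_sub {a c l : ℝ} (hg : HasRightDerivOn g g' (Ico a T)) (haT : a < T)
    (h0 : ∀ t ∈ Ico a T, c ≤ g' t) (hl : Tendsto g (𝓝[<] T) (𝓝 l)) : c * (T - a) ≤ l - g a := by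
  have h1 : Tendsto (fun t : ℝ => c * t) (𝓝[<] T) (𝓝 (c * T)) :=
    (Continuous.tendsto (by fun_prop) T).mono_left nhdsWithin_le_nhds
  have h2 := (hg.sub (id.const_mul c)).le_limit haT (fun t ht => by linarith [h0 t ht]) (hl.sub h1)
  linarith

theorem limit_sub_le_mul {a c l : ℝ} (hg : HasRightDerivOn g g' (Ico a T)) (haT : a < T)
    (h0 : ∀ t ∈ Ico a T, g' t ≤ c) (hl : Tendsto g (𝓝[<] T) (𝓝 l)) : l - g a ≤ c * (T - a) := by
  have := (hg.const_mul (-1)).mul_le_limit_sub (c := -c) haT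
    (fun t ht => by linarith [h0 t ht]) (hl.const_mul (-1))
  linarith

end HasRightDerivOn

/-- What holds just before `T` holds on an interval that ends at `T`. -/
theorem eventually_forall_Ico {T : ℝ} {P : ℝ → Prop} (h : ∀ᶠ t in 𝓝[<] T, P t) :
    ∀ᶠ t in 𝓝[<] T, t < T ∧ ∀ s ∈ Ico t T, P s := by
  obtain ⟨b, hb, hP⟩ := mem_nhdsLT_iff_exists_Ioo_subset.1 h
  filter_upwards [Ioo_mem_nhdsLT hb] with t ht
  exact ⟨ht.2, fun s hs => hP ⟨ht.1.trans_le hs.1, hs.2⟩⟩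

theorem exists_mem_Ioo_of_frequently {T : ℝ} {P : ℝ → Prop} (h : ∃ᶠ t in 𝓝[<] T, P t) :
    ∀ t < T, ∃ s ∈ Ioo t T, P s := fun t ht => by
  obtain ⟨s, hs, hs'⟩ := (h.and_eventually (Ioo_mem_nhdsLT ht)).exists
  exact ⟨s, hs', hs⟩

theorem eventually_sub_lt {T : ℝ} {φ : ℝ → ℝ} (hφ : Continuous φ) {c : ℝ} (hc : φ 0 < c) :
    ∀ᶠ t in 𝓝[<] T, φ (T - t) < c := by
  have : Tendsto (fun t => φ (T - t)) (𝓝[<] T) (𝓝 (φ (T - T))) :=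
    (Continuous.tendsto (by fun_prop) T).mono_left nhdsWithin_le_nhds
  rw [sub_self] at this
  exact this.eventually (gt_mem_nhds hc)

theorem eventually_nonneg_left {T : ℝ} (hT : 0 < T) : ∀ᶠ t in 𝓝[<] T, 0 ≤ t := by
  filter_upwards [Ioo_mem_nhdsLT hT] with t ht using ht.1.le

/-! ### Exclusion of inelastic collapse -/

namespace IsMotion

variable {μ γ : ℝ} {u : ℝ → State} {T : ℝ}

/-- If the force on the lower mass is directed downwards and decays at most like a power of the
remaining time, then contacts accumulate at `T` only if the lower mass rests on the floor. -/
theorem eventually_rest_of_drive_le (h : IsMotion μ γ T u) (hμ : 0 < μ) (hγ : 0 < γ) (hT : 0 < T)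
    (m : ℕ) {C : ℝ} (hfreq : ∃ᶠ t in 𝓝[<] T, (u t).x = 0)
    (hf : ∀ᶠ t in 𝓝[<] T, drive μ γ (u t) ≤ 0 ∧
      (driveRate μ γ (u t) - μ * drive μ γ (u t) + (μ - μ ^ 3) * (u t).x) * (T - t) ≤
        (m + 1) * (-drive μ γ (u t)) ∧
      |drive μ γ (u t)| ≤ C * (T - t) ^ m) :
    ∀ᶠ t in 𝓝[<] T, (u t).x = 0 := by
  by_contra hcon
  obtain ⟨t₀, hx₀, hf₀, ht₀⟩ := ((not_eventually.1 hcon).and_eventually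
    ((eventually_forall_Ico hf).and (eventually_nonneg_left hT))).exists
  obtain ⟨htT, hf₀⟩ := hf₀
  have hsub : Ico t₀ T ⊆ timeDomain T := by
    rw [timeDomain_coe]; exact Ico_subset_Ico_left ht₀
  set a := μ ^ 2 - 1 / 2
  set K := |a + 1| + 2 * μ with hK
  -- The summand x²/2 makes H positive off the floor when the drive is nonpositive. Its price, the
  -- cross term (a + 1) x v, is absorbed by K H.
  let H : ℝ → ℝ := fun t => (u t).v ^ 2 / 2 - drive μ γ (u t) * (u t).x + (u t).x ^ 2 / 2
  let f' : ℝ → ℝ := fun t =>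
    driveRate μ γ (u t) - μ * drive μ γ (u t) + (μ - μ ^ 3) * (u t).x
  have hH : HasRightDerivOn H (fun t => (a + 1) * ((u t).x * (u t).v) - μ * (u t).v ^ 2
      - f' t * (u t).x) (timeDomain T) := by
    have h1 := (h.hasRightDerivOn_sq_v.sub (h.hasRightDerivOn_drive.mul h.hasRightDerivOn_x)).add
      ((h.hasRightDerivOn_x.mul h.hasRightDerivOn_x).const_mul (1 / 2))
    have h2 := h1.congr_deriv (k := fun t => (a + 1) * ((u t).x * (u t).v) - μ * (u t).v ^ 2
      - f' t * (u t).x) fun t _ => by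
        simp only [lowerAcc_eq_drive, f', a]; ring
    convert h2 using 2 with t
    simp only [H]; ring
  -- Integrating factor for H' ≥ -(K + (m + 1)/(T - t)) H. Monotonicity of H k yields the lower
  -- bound H ≥ c (T - t)^(m + 1).
  let k : ℝ → ℝ := fun t => Real.exp (K * t) * ((T - t) ^ (m + 1))⁻¹
  have hk : HasRightDerivOn k (fun t => k t * (K + (m + 1) / (T - t))) (Ico t₀ T) := by
    refine .of_hasDerivAt fun t ht => ?_
    have hTt : T - t ≠ 0 := (sub_pos.2 ht.2).ne'
    have e1 : HasDerivAt (fun t => Real.exp (K * t)) (Real.exp (K * t) * K) t := by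
      simpa using ((hasDerivAt_id t).const_mul K).exp
    have e2 := (((hasDerivAt_id t).const_sub T).pow (m + 1)).inv (pow_ne_zero _ hTt)
    refine (e1.mul e2).congr_deriv ?_
    simp only [k, id, Pi.inv_apply, Pi.pow_apply]
    push_cast
    field_simp
    ring
  have hmono := (hH.mono hsub).mul hk
  have hkpos : ∀ t ∈ Ico t₀ T, 0 < k t := fun t ht =>
    mul_pos (Real.exp_pos _) (inv_pos.2 (pow_pos (sub_pos.2 ht.2) _))
  have hJ : ∀ t ∈ Ico t₀ T, H t₀ * k t₀ ≤ H t * k t := by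
    intro t ht
    refine hmono.le_of_nonneg ht.1 (fun r hr => ⟨hr.1, hr.2.trans_lt ht.2⟩) fun r hr => ?_
    have hr' : r ∈ Ico t₀ T := ⟨hr.1, hr.2.trans ht.2⟩
    obtain ⟨h1, h2, -⟩ := hf₀ r hr'
    have hTr : 0 < T - r := sub_pos.2 hr'.2
    have hx := h.nonneg r (hsub hr')
    have h3 : f' r * (u r).x ≤ (m + 1) / (T - r) * (-drive μ γ (u r) * (u r).x) := by
      have : f' r ≤ (m + 1) * (-drive μ γ (u r)) / (T - r) := (le_div_iff₀ hTr).2 h2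
      calc f' r * (u r).x ≤ (m + 1) * (-drive μ γ (u r)) / (T - r) * (u r).x := by gcongr
        _ = _ := by ring
    have h4 : (m + 1) / (T - r) * (-drive μ γ (u r) * (u r).x) ≤ (m + 1) / (T - r) * H r := by
      gcongr
      simp only [H]; nlinarith [sq_nonneg (u r).v, sq_nonneg (u r).x]
    have h5 : -(|a + 1| * (((u r).x ^ 2 + (u r).v ^ 2) / 2)) ≤ (a + 1) * ((u r).x * (u r).v) := by
      have : |(a + 1) * ((u r).x * (u r).v)| ≤ |a + 1| * (((u r).x ^ 2 + (u r).v ^ 2) / 2) := by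
        rw [abs_mul]
        gcongr
        rw [abs_le]
        constructor <;> nlinarith [sq_nonneg ((u r).x + (u r).v), sq_nonneg ((u r).x - (u r).v)]
      exact (abs_le.1 this).1
    have h6 : K * ((u r).v ^ 2 / 2 + (u r).x ^ 2 / 2) ≤ K * H r := by
      have : 0 ≤ K := by positivity
      gcongr
      simp only [H]; nlinarith
    have h7 : 0 ≤ (a + 1) * ((u r).x * (u r).v) - μ * (u r).v ^ 2 - f' r * (u r).x
        + H r * (K + (m + 1) / (T - r)) := by
      have : 0 ≤ μ * (u r).x ^ 2 := by positivity
      rw [hK] at h6 ⊢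
      linarith
    have := mul_nonneg (hkpos r hr').le h7
    linarith
  have hH₀ : 0 < H t₀ := by
    have hx : 0 < (u t₀).x := lt_of_le_of_ne (h.nonneg t₀ (hsub (left_mem_Ico.2 htT))) (Ne.symm hx₀)
    have := (hf₀ t₀ (left_mem_Ico.2 htT)).1
    simp only [H]; nlinarith [sq_nonneg (u t₀).v, pow_pos hx 2]
  set c := H t₀ * k t₀ * (Real.exp (K * T))⁻¹ with hc
  have hc0 : 0 < c := by have := hkpos t₀ (left_mem_Ico.2 htT); positivity
  have hlow : ∀ t ∈ Ico t₀ T, c * (T - t) ^ (m + 1) ≤ H t := by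
    intro t ht
    have h1 := hJ t ht
    have hTt : 0 < (T - t) ^ (m + 1) := pow_pos (sub_pos.2 ht.2) _
    have hH0 : 0 ≤ H t := by
      have : 0 < H t * k t := (mul_pos hH₀ (hkpos t₀ (left_mem_Ico.2 htT))).trans_le h1
      exact (pos_of_mul_pos_left this (hkpos t ht).le).le
    have h2 : H t * k t ≤ H t * (Real.exp (K * T) * ((T - t) ^ (m + 1))⁻¹) := by
      simp only [k]
      have : 0 ≤ K := by positivity
      gcongr
      exact ht.2.le
    rw [hc, mul_right_comm, ← div_eq_mul_inv, div_le_iff₀ (Real.exp_pos _)]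
    calc H t₀ * k t₀ * (T - t) ^ (m + 1)
        ≤ H t * (Real.exp (K * T) * ((T - t) ^ (m + 1))⁻¹) * (T - t) ^ (m + 1) := by
          exact mul_le_mul_of_nonneg_right (h1.trans h2) hTt.le
      _ = H t * Real.exp (K * T) := by field_simp
  have hC0 : 0 ≤ C := by
    have := (abs_nonneg _).trans (hf₀ t₀ (left_mem_Ico.2 htT)).2.2
    exact nonneg_of_mul_nonneg_left this (pow_pos (sub_pos.2 htT) _)
  -- At a contact H = v²/2 ≤ 2 C² (T - s)^(2m + 2), by `abs_velocity_le` with B = C (T - s)^m. If s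
  -- is late enough, this is below c (T - s)^(m + 1).
  obtain ⟨s, hxs, ⟨hs1, hs2⟩, hs3⟩ := (hfreq.and_eventually (((eventually_sub_lt (T := T)
    (φ := fun D => 2 * C ^ 2 * D ^ (m + 1)) (by fun_prop) (c := c) (by simpa using hc0)).and
    (eventually_sub_lt (T := T) (φ := fun D => (|a| * D + μ) * D) (by fun_prop) (c := 1 / 2)
      (by norm_num))).and (Ioo_mem_nhdsLT htT))).exists
  have hD : 0 < T - s := sub_pos.2 hs3.2
  have hv := h.abs_velocity_le hμ hγ (B := C * (T - s) ^ m) (ht₀.trans hs3.1.le) hs3.2 hxs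
    (exists_mem_Ioo_of_frequently hfreq) (fun t ht => by
      refine (hf₀ t ⟨hs3.1.le.trans ht.1, ht.2⟩).2.2.trans ?_
      have := sub_nonneg.2 ht.2.le
      gcongr
      exact ht.1) hs2.le s (left_mem_Ico.2 hs3.2)
  have h1 := hlow s ⟨hs3.1.le, hs3.2⟩
  simp only [H, hxs] at h1
  have h2 : (u s).v ^ 2 ≤ (2 * (C * (T - s) ^ m) * (T - s)) ^ 2 := sq_le_sq' (abs_le.1 hv).1
    (abs_le.1 hv).2
  have h3 : (2 * (C * (T - s) ^ m) * (T - s)) ^ 2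
      = 2 * (2 * C ^ 2 * (T - s) ^ (m + 1) * (T - s) ^ (m + 1)) := by ring
  have h4 := mul_lt_mul_of_pos_right hs1 (pow_pos hD (m + 1))
  linarith

/-- There is no inelastic collapse: if contacts accumulate at `T`, then the lower mass rests on the
floor before `T`. -/
theorem eventually_rest_of_frequently (h : IsMotion μ γ T u) (hμ : 0 < μ) (hγ : 0 < γ) (hT : 0 < T)
    (hfreq : ∃ᶠ t in 𝓝[<] T, (u t).x = 0) : ∀ᶠ t in 𝓝[<] T, (u t).x = 0 := by
  obtain ⟨C, hC, hbd⟩ := h.exists_bound hμ hγ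
  have hdom : timeDomain T = Ico 0 T := timeDomain_coe T
  rw [hdom] at hbd
  have hfr := exists_mem_Ioo_of_frequently hfreq
  have dx := h.hasRightDerivOn_x
  have dw := h.hasRightDerivOn_w
  have dp := h.hasRightDerivOn_stretch
  have df := h.hasRightDerivOn_drive
  have dq := h.hasRightDerivOn_driveRate
  rw [hdom] at dx dw dp df dq
  obtain ⟨x₁, lx⟩ := dx.exists_tendsto hT fun t ht => (hbd t ht).1
  obtain rfl : x₁ = 0 := by
    by_contra hne
    obtain ⟨t, h1, h2⟩ := (hfreq.and_eventually (lx.eventually_ne hne)).exists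
    exact h2 h1
  obtain ⟨w₁, lw⟩ := dw.exists_tendsto hT fun t ht => (hbd t ht).2.2.2.2.2
  obtain ⟨p₁, lp⟩ := dp.exists_tendsto hT fun t ht => (abs_sub _ _).trans
    (add_le_add (hbd t ht).2.1 (hbd t ht).1)
  obtain ⟨f₁, lf⟩ : ∃ f₁, Tendsto (fun t => drive μ γ (u t)) (𝓝[<] T) (𝓝 f₁) := by
    simp only [drive_eq_stretch]
    exact ⟨_, (((lp.div_const 2).const_add _).add (lw.const_mul μ)).sub (lx.const_mul _)⟩
  obtain ⟨q₁, lq⟩ : ∃ q₁, Tendsto (fun t => driveRate μ γ (u t)) (𝓝[<] T) (𝓝 q₁) :=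
    ⟨_, ((lw.div_const 2).sub_const _).sub ((lx.const_mul μ).div_const 2)⟩
  have lf' : Tendsto (fun t => driveRate μ γ (u t) - μ * drive μ γ (u t) + (μ - μ ^ 3) * (u t).x)
      (𝓝[<] T) (𝓝 (q₁ - μ * f₁)) := by
    simpa using (lq.sub (lf.const_mul μ)).add (lx.const_mul (μ - μ ^ 3))
  have ev0 := eventually_nonneg_left hT
  have hsub : ∀ {t}, 0 ≤ t → Ico t T ⊆ Ico 0 T := fun h0 => Ico_subset_Ico_left h0
  have lfa : Tendsto (fun t => drive μ γ (u t) + (μ ^ 2 - 1 / 2) * (u t).x) (𝓝[<] T) (𝓝 f₁) := by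
    simpa using lf.add (lx.const_mul (μ ^ 2 - 1 / 2))
  -- the velocity tends to zero, hence the height is small compared to the remaining time
  have hB : ∃ B, ∀ t ∈ Ico 0 T, |drive μ γ (u t)| ≤ B := by
    refine ⟨2 * γ + C / 2 + μ * C + |μ ^ 2 - 1 / 2| * C, fun t ht => ?_⟩
    obtain ⟨-, h2, h3, h4, -, -⟩ := hbd t ht
    rw [drive_eq_stretch]
    have h0 := h.nonneg t (hdom ▸ ht)
    have e1 : |μ * (u t).w| ≤ μ * C := by rw [abs_mul, abs_of_pos hμ]; gcongr
    have e2 : |(μ ^ 2 - 1 / 2) * (u t).x| ≤ |μ ^ 2 - 1 / 2| * C := by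
      rw [abs_mul, abs_of_nonneg h0]; gcongr
    rw [abs_le] at h4 e1 e2 ⊢
    constructor <;> linarith
  obtain ⟨B, hB⟩ := hB
  have lv : ∀ ε > 0, ∀ᶠ t in 𝓝[<] T, |(u t).v| ≤ ε := by
    intro ε hε
    obtain ⟨s, hxs, ⟨h1, h2⟩, h3⟩ := (hfreq.and_eventually (((eventually_sub_lt (T := T)
      (φ := fun D => 2 * B * D) (by fun_prop) (c := ε) (by simpa using hε)).and
      (eventually_sub_lt (T := T) (φ := fun D => (|μ ^ 2 - 1 / 2| * D + μ) * D) (by fun_prop)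
        (c := 1 / 2) (by norm_num))).and (Ioo_mem_nhdsLT hT))).exists
    have := h.abs_velocity_le hμ hγ h3.1.le h3.2 hxs hfr
      (fun t ht => hB t (hsub h3.1.le ht)) h2.le
    filter_upwards [Ioo_mem_nhdsLT h3.2] with t ht
    exact (this t ⟨ht.1.le, ht.2⟩).trans h1.le
  have hx : ∀ ε > 0, ∀ᶠ t in 𝓝[<] T, |(u t).x| ≤ ε * (T - t) := by
    intro ε hε
    filter_upwards [eventually_forall_Ico (lv ε hε), ev0] with t ht h0
    have h1 := (dx.mono (hsub h0)).mul_le_limit_sub ht.1 (fun s hs => (abs_le.1 (ht.2 s hs)).1) lx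
    have h2 := (dx.mono (hsub h0)).limit_sub_le_mul ht.1 (fun s hs => (abs_le.1 (ht.2 s hs)).2) lx
    rw [abs_le]; constructor <;> linarith
  have hxk : ∀ k : ℝ, ∀ ε > 0, ∀ᶠ t in 𝓝[<] T, |k * (u t).x| ≤ ε * (T - t) := by
    intro k ε hε
    filter_upwards [hx (ε / (|k| + 1)) (by positivity), self_mem_nhdsWithin] with t ht htT
    rw [abs_mul]
    have h0 : 0 ≤ T - t := sub_nonneg.2 (le_of_lt htT)
    calc |k| * |(u t).x| ≤ (|k| + 1) * (ε / (|k| + 1) * (T - t)) := by gcongr; linarith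
      _ = ε * (T - t) := by field_simp
  rcases lt_trichotomy f₁ 0 with hf | rfl | hf
  · -- downward force at `T`
    have hb : ∀ᶠ t in 𝓝[<] T, |driveRate μ γ (u t) - μ * drive μ γ (u t) +
        (μ - μ ^ 3) * (u t).x| < |q₁ - μ * f₁| + 1 :=
      lf'.abs.eventually (gt_mem_nhds (by linarith))
    -- The force has a negative limit: m = 0, and the bounded f' times T - t becomes negligible.
    refine h.eventually_rest_of_drive_le hμ hγ hT 0 (C := B) hfreq ?_
    filter_upwards [hb, lf.eventually (gt_mem_nhds (show f₁ < f₁ / 2 by linarith)),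
      eventually_sub_lt (T := T) (φ := fun D => (|q₁ - μ * f₁| + 1) * D) (by fun_prop)
        (c := -f₁ / 2) (by simpa using by linarith), Ioo_mem_nhdsLT hT] with t h1 h2 h3 h4
    have hTt := sub_pos.2 h4.2
    refine ⟨by linarith, ?_, by simpa using hB t ⟨h4.1.le, h4.2⟩⟩
    have := mul_le_mul_of_nonneg_right ((le_abs_self _).trans h1.le) hTt.le
    push_cast
    linarith
  -- If f vanishes at T then f' tends to q₁, whose sign decides that of f before T. If q₁ = 0 as
  -- well, then q' → -γ decides.
  · rw [mul_zero, sub_zero] at lf'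
    rcases lt_trichotomy q₁ 0 with hq | rfl | hq
    -- Here f decreases to 0, hence is positive of order T - t, and the height is o(T - t).
    · refine (h.false_of_force_pos hT hfr ?_).elim
      filter_upwards [eventually_forall_Ico (lf'.eventually (gt_mem_nhds
        (show q₁ < q₁ / 2 by linarith))), ev0, hxk (μ ^ 2 - 1 / 2) (-q₁ / 4) (by linarith)]
        with t h1 h0 h2
      have h3 := (df.mono (hsub h0)).limit_sub_le_mul h1.1 (fun s hs => (h1.2 s hs).le) lf
      have h4 := (abs_le.1 h2).1
      have := mul_pos (neg_pos.2 hq) (sub_pos.2 h1.1)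
      linarith
    · have lq' : Tendsto (fun t => -γ - drive μ γ (u t) / 2 - (μ ^ 2 - 1 / 2) / 2 * (u t).x)
          (𝓝[<] T) (𝓝 (-γ)) := by
        simpa using ((lf.div_const 2).const_sub (-γ)).sub (lx.const_mul ((μ ^ 2 - 1 / 2) / 2))
      have hq1 : ∀ᶠ t in 𝓝[<] T, 9 / 10 * γ * (T - t) ≤ driveRate μ γ (u t) ∧
          driveRate μ γ (u t) ≤ 11 / 10 * γ * (T - t) := by
        filter_upwards [eventually_forall_Ico (lq'.eventually (Ioo_mem_nhds
          (show -(11 / 10 * γ) < -γ by linarith) (show -γ < -(9 / 10 * γ) by linarith))), ev0]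
          with t h1 h0
        have h2 := (dq.mono (hsub h0)).mul_le_limit_sub h1.1 (fun s hs => (h1.2 s hs).1.le) lq
        have h3 := (dq.mono (hsub h0)).limit_sub_le_mul h1.1 (fun s hs => (h1.2 s hs).2.le) lq
        constructor <;> linarith
      have hf1 : ∀ᶠ t in 𝓝[<] T, |μ * drive μ γ (u t)| ≤ γ / 20 * (T - t) := by
        have hε : 0 < γ / 20 / μ := by positivity
        filter_upwards [eventually_forall_Ico (lf'.eventually (Ioo_mem_nhds
          (neg_lt_zero.2 hε) hε)), ev0] with t h1 h0
        have h2 := (df.mono (hsub h0)).mul_le_limit_sub h1.1 (fun s hs => (h1.2 s hs).1.le) lf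
        have h3 := (df.mono (hsub h0)).limit_sub_le_mul h1.1 (fun s hs => (h1.2 s hs).2.le) lf
        have h4 : |drive μ γ (u t)| ≤ γ / 20 / μ * (T - t) := by
          rw [abs_le]; constructor <;> linarith
        rw [abs_mul, abs_of_pos hμ]
        calc μ * |drive μ γ (u t)| ≤ μ * (γ / 20 / μ * (T - t)) := by gcongr
          _ = _ := by field_simp
      have hf2 : ∀ᶠ t in 𝓝[<] T, 4 / 5 * γ * (T - t) ≤ driveRate μ γ (u t) -
          μ * drive μ γ (u t) + (μ - μ ^ 3) * (u t).x ∧ driveRate μ γ (u t) -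
          μ * drive μ γ (u t) + (μ - μ ^ 3) * (u t).x ≤ 6 / 5 * γ * (T - t) := by
        filter_upwards [hq1, hf1, hxk (μ - μ ^ 3) (γ / 20) (by positivity)] with t h1 h2 h3
        rw [abs_le] at h2 h3
        constructor <;> linarith
      have hsq : ∀ c : ℝ, HasRightDerivOn (fun t => c * (T - t) ^ 2) (fun t => -2 * c * (T - t))
          (Ico 0 T) := fun c => .of_hasDerivAt fun t _ => by
        have := (((hasDerivAt_id t).const_sub T).pow 2).const_mul c
        refine this.congr_deriv ?_
        simp only [id]; ring
      have lsq : ∀ c : ℝ, Tendsto (fun t => c * (T - t) ^ 2) (𝓝[<] T) (𝓝 0) := fun c => by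
        have : Tendsto (fun t => c * (T - t) ^ 2) (𝓝[<] T) (𝓝 (c * (T - T) ^ 2)) :=
          (Continuous.tendsto (by fun_prop) T).mono_left nhdsWithin_le_nhds
        simpa using this
      -- Integrating 4/5 γ (T - t) ≤ f' ≤ 6/5 γ (T - t) puts -f between 2/5 and 3/5 of γ (T - t)².
      -- The required inequality with m + 1 = 3 holds because 6/5 = 3 · 2/5.
      refine h.eventually_rest_of_drive_le hμ hγ hT 2 (C := 3 / 5 * γ) hfreq ?_
      filter_upwards [eventually_forall_Ico hf2, ev0] with t h1 h0
      have h2 := ((df.add (hsq (2 / 5 * γ))).mono (hsub h0)).le_limit h1.1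
        (fun s hs => by linarith [(h1.2 s hs).1]) (lf.add (lsq _))
      have h3 := ((((df.add (hsq (3 / 5 * γ))).const_mul (-1))).mono (hsub h0)).le_limit h1.1
        (fun s hs => by linarith [(h1.2 s hs).2]) ((lf.add (lsq _)).const_mul (-1))
      have hTt := sub_pos.2 h1.1
      have h4 : 0 < γ * (T - t) ^ 2 := by positivity
      refine ⟨by linarith, ?_, ?_⟩
      · have := mul_le_mul_of_nonneg_right (h1.2 t (left_mem_Ico.2 h1.1)).2 hTt.le
        push_cast
        nlinarith
      · rw [abs_of_nonpos (by linarith)]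
        linarith
    -- Now -f lies between 3/4 and 5/4 of q₁ (T - t), and 5/4 ≤ 2 · 3/4 meets the requirement for m
    -- = 1.
    · refine h.eventually_rest_of_drive_le hμ hγ hT 1 (C := 5 / 4 * q₁) hfreq ?_
      filter_upwards [eventually_forall_Ico (lf'.eventually (Ioo_mem_nhds
        (show 3 / 4 * q₁ < q₁ by linarith) (show q₁ < 5 / 4 * q₁ by linarith))), ev0] with t h1 h0
      have h2 := (df.mono (hsub h0)).mul_le_limit_sub h1.1 (fun s hs => (h1.2 s hs).1.le) lf
      have h3 := (df.mono (hsub h0)).limit_sub_le_mul h1.1 (fun s hs => (h1.2 s hs).2.le) lf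
      have h4 := mul_pos hq (sub_pos.2 h1.1)
      refine ⟨by linarith, ?_, ?_⟩
      · have := mul_le_mul_of_nonneg_right (h1.2 t (left_mem_Ico.2 h1.1)).2.le
          (sub_pos.2 h1.1).le
        push_cast
        linarith
      · rw [abs_of_nonpos (by linarith)]
        linarith
  · exact (h.false_of_force_pos hT hfr (lfa.eventually (lt_mem_nhds hf))).elim

end IsMotion

/-! ### Motions on bounded intervals: finitely many impacts and a limit state -/

namespace IsMotion

variable {μ γ : ℝ} {u : ℝ → State}

theorem restrict {T T' : EReal} (h : IsMotion μ γ T u) (hT : T' ≤ T) : IsMotion μ γ T' u where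
  nonneg t ht := h.nonneg t (timeDomain_mono hT ht)
  cont_x := h.cont_x.mono (timeDomain_mono hT)
  right_deriv_x t ht := h.right_deriv_x t (timeDomain_mono hT ht)
  right_cont_v t ht := h.right_cont_v t (timeDomain_mono hT ht)
  deriv_y t ht := (h.deriv_y t (timeDomain_mono hT ht)).mono (timeDomain_mono hT)
  cont_w := h.cont_w.mono (timeDomain_mono hT)
  flight t ht := h.flight t (timeDomain_mono hT ht)
  impact t ht := h.impact t (timeDomain_mono hT ht)
  contact t ht := h.contact t (timeDomain_mono hT ht)
  mode_right t ht := h.mode_right t (timeDomain_mono hT ht)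
  mode_left t ht := h.mode_left t (timeDomain_mono hT ht)

/-- While the ball stays in one mode there are no impacts. -/
theorem eventually_notMem_impactTimes {T : EReal} (h : IsMotion μ γ T u) {l : Filter ℝ}
    (hl : ∀ {P : ℝ → Prop}, (∀ᶠ s in l, P s) → ∀ᶠ s in l, ∀ᶠ r in 𝓝 s, P r)
    (hm : (∀ᶠ s in l, 0 < (u s).x) ∨ (∀ᶠ s in l, (u s).x = 0)) :
    ∀ᶠ s in l, s ∉ impactTimes T u := by
  rcases hm with hx | hx
  · filter_upwards [hx] with s hs hi using hs.ne' hi.2.1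
  · filter_upwards [hx, hl hx] with s hs hs' hi
    exact hi.2.2 (h.velocity_eq_zero_of_eventually hi.1 hs (hs'.filter_mono nhdsWithin_le_nhds))

theorem _root_.BouncingBall.eventually_eventually_left {t : ℝ} {P : ℝ → Prop}
    (h : ∀ᶠ s in 𝓝[<] t, P s) : ∀ᶠ s in 𝓝[<] t, ∀ᶠ r in 𝓝 s, P r := by
  obtain ⟨b, hb, hP⟩ := mem_nhdsLT_iff_exists_Ioo_subset.1 h
  filter_upwards [Ioo_mem_nhdsLT hb] with s hs
  filter_upwards [Ioo_mem_nhds hs.1 hs.2] with r hr using hP hr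

section finite

variable {T : ℝ}

/-- At the end of a bounded time interval, the ball is either in flight or resting. -/
theorem mode_end (h : IsMotion μ γ T u) (hμ : 0 < μ) (hγ : 0 < γ) (hT : 0 < T) :
    (∀ᶠ s in 𝓝[<] T, 0 < (u s).x) ∨ (∀ᶠ s in 𝓝[<] T, (u s).x = 0) := by
  by_cases hfreq : ∃ᶠ t in 𝓝[<] T, (u t).x = 0
  · exact Or.inr (h.eventually_rest_of_frequently hμ hγ hT hfreq)
  · left
    filter_upwards [not_frequently.1 hfreq, Ioo_mem_nhdsLT hT] with t ht ht'
    exact lt_of_le_of_ne (h.nonneg t (by rw [timeDomain_coe]; exact ⟨ht'.1.le, ht'.2⟩)) (Ne.symm ht)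

/-- Infinitely many impacts would accumulate at some z in [0, T]. Just before and just after z the
ball is in a single mode, which excludes impacts. -/
theorem finite_impactTimes (h : IsMotion μ γ T u) (hμ : 0 < μ) (hγ : 0 < γ) :
    (impactTimes T u).Finite := by
  have hsub : impactTimes T u ⊆ Ico 0 T := fun t ht => by
    have := ht.1; rwa [timeDomain_coe] at this
  by_contra hinf
  obtain ⟨z, hz, hacc⟩ := Set.Infinite.exists_accPt_of_subset_isCompact (K := Icc 0 T) hinf
    isCompact_Icc (hsub.trans Ico_subset_Icc_self)
  rw [accPt_iff_frequently_nhdsNE] at hacc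
  refine hacc ?_
  rw [← Iio_union_Ioi, nhdsWithin_union, eventually_sup]
  constructor
  · rcases hz.1.eq_or_lt with h0 | h0
    · subst h0
      filter_upwards [self_mem_nhdsWithin] with s hs hi
      exact (hsub hi).1.not_gt hs
    -- Restricting to [0, z) makes z an end time, so that `mode_end` also covers z = T.
    · have := h.restrict (T' := z) (EReal.coe_le_coe_iff.2 hz.2)
      exact h.eventually_notMem_impactTimes eventually_eventually_left (this.mode_end hμ hγ h0)
  · rcases hz.2.eq_or_lt with h0 | h0
    · subst h0
      filter_upwards [self_mem_nhdsWithin] with s hs hi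
      exact (hsub hi).2.not_gt hs
    · exact h.eventually_notMem_impactTimes eventually_eventually_right
        (h.mode_right z (by rw [timeDomain_coe]; exact ⟨hz.1, h0⟩))

/-- The limit state is needed to continue the motion. The sign of its velocity on the floor makes
the reflected state admissible. -/
theorem exists_limit (h : IsMotion μ γ T u) (hμ : 0 < μ) (hγ : 0 < γ) (hT : 0 < T) :
    ∃ x v y w : ℝ, 0 ≤ x ∧ (x = 0 → v ≤ 0) ∧ Tendsto (fun t => (u t).x) (𝓝[<] T) (𝓝 x) ∧
      Tendsto (fun t => (u t).v) (𝓝[<] T) (𝓝 v) ∧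
      Tendsto (fun t => (u t).y) (𝓝[<] T) (𝓝 y) ∧
      Tendsto (fun t => (u t).w) (𝓝[<] T) (𝓝 w) := by
  obtain ⟨C, hC, hbd⟩ := h.exists_bound hμ hγ
  have hdom : timeDomain T = Ico 0 T := timeDomain_coe T
  rw [hdom] at hbd
  have dx := h.hasRightDerivOn_x
  have dy := h.hasRightDerivOn_y
  have dw := h.hasRightDerivOn_w
  rw [hdom] at dx dw dy
  obtain ⟨x, lx⟩ := dx.exists_tendsto hT fun t ht => (hbd t ht).1
  obtain ⟨y, ly⟩ := dy.exists_tendsto hT fun t ht => (hbd t ht).2.1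
  obtain ⟨w, lw⟩ := dw.exists_tendsto hT fun t ht => (hbd t ht).2.2.2.2.2
  have hx0 : 0 ≤ x := by
    refine ge_of_tendsto lx ?_
    filter_upwards [Ioo_mem_nhdsLT hT] with t ht
    exact h.nonneg t (by rw [hdom]; exact ⟨ht.1.le, ht.2⟩)
  rcases h.mode_end hμ hγ hT with hx | hx
  · obtain ⟨a, ⟨ha, ha'⟩, ha0⟩ := ((eventually_forall_Ico hx).and (Ioo_mem_nhdsLT hT)).exists
    have hsub : Ico a T ⊆ Ico 0 T := Ico_subset_Ico_left ha0.1.le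
    have dv := h.hasRightDerivOn_v ha0.1.le (hdom ▸ hsub) fun s hs => ha' s ⟨hs.1.le, hs.2⟩
    obtain ⟨v, lv⟩ := dv.exists_tendsto ha fun t ht => (hbd t (hsub ht)).2.2.2.2.1
    refine ⟨x, v, y, w, hx0, fun hx1 => ?_, lx, lv, ly, lw⟩
    -- A positive limit velocity would make the height increase to 0 from positive values.
    by_contra! hv
    obtain ⟨b, ⟨hb, hb'⟩, hb0⟩ := ((eventually_forall_Ico ((lv.eventually (lt_mem_nhds hv)).and
      hx)).and (eventually_nonneg_left hT)).exists
    have := (dx.mono (Ico_subset_Ico_left hb0)).le_limit hb (fun s hs => (hb' s hs).1.le) lx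
    have := (hb' b (left_mem_Ico.2 hb)).2
    linarith
  · refine ⟨x, 0, y, w, hx0, fun _ => le_rfl, lx, tendsto_const_nhds.congr' ?_, ly, lw⟩
    filter_upwards [hx, eventually_eventually_left hx, Ioo_mem_nhdsLT hT] with s h1 h2 h3
    exact (h.velocity_eq_zero_of_eventually (by rw [hdom]; exact ⟨h3.1.le, h3.2⟩) h1
      (h2.filter_mono nhdsWithin_le_nhds)).symm

end finite

end IsMotion

/-! ### The rules of motion at one time -/

/-- `u` obeys the rules of motion at the time `t`. -/
structure MotionAt (μ γ : ℝ) (u : ℝ → State) (t : ℝ) : Prop where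
  nonneg : 0 ≤ (u t).x
  cont_x : ContinuousWithinAt (fun t => (u t).x) (Ici 0) t
  right_deriv_x : HasDerivWithinAt (fun s => (u s).x) (u t).v (Ioi t) t
  right_cont_v : Tendsto (fun s => (u s).v) (𝓝[>] t) (𝓝 (u t).v)
  deriv_y : HasDerivWithinAt (fun s => (u s).y) (u t).w (Ici 0) t
  cont_w : ContinuousWithinAt (fun t => (u t).w) (Ici 0) t
  flight : 0 < t → 0 < (u t).x →
    HasDerivAt (fun s => (u s).x) (u t).v t ∧
    HasDerivAt (fun s => (u s).v) (lowerAcc μ γ (u t)) t ∧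
    HasDerivAt (fun s => (u s).w) (upperAcc μ γ (u t)) t
  impact : 0 < t → (u t).x = 0 → Tendsto (fun s => (u s).v) (𝓝[<] t) (𝓝 (-(u t).v))
  contact : 0 < t → (∀ᶠ s in 𝓝 t, (u s).x = 0) →
    HasDerivAt (fun s => (u s).w) (upperAcc μ γ (u t)) t ∧ floorForce μ γ (u t) ≤ 0
  mode_right : (∀ᶠ s in 𝓝[>] t, 0 < (u s).x) ∨ (∀ᶠ s in 𝓝[>] t, (u s).x = 0)
  mode_left : 0 < t → (∀ᶠ s in 𝓝[<] t, 0 < (u s).x) ∨ (∀ᶠ s in 𝓝[<] t, (u s).x = 0)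

variable {μ γ : ℝ} {u u' : ℝ → State} {T : EReal} {t : ℝ}

theorem isMotion_iff_motionAt : IsMotion μ γ T u ↔ ∀ t ∈ timeDomain T, MotionAt μ γ u t := by
  have hsub : timeDomain T ⊆ Ici 0 := fun t ht => ht.1
  refine ⟨fun h t ht => ?_, fun h => ?_⟩
  · have hn := nhdsWithin_timeDomain ht
    exact
    { nonneg := h.nonneg t ht
      cont_x := by have := h.cont_x t ht; rwa [ContinuousWithinAt, hn] at this
      right_deriv_x := h.right_deriv_x t ht
      right_cont_v := h.right_cont_v t ht
      deriv_y := (h.deriv_y t ht).mono_of_mem_nhdsWithin (timeDomain_mem_nhdsWithin ht)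
      cont_w := by have := h.cont_w t ht; rwa [ContinuousWithinAt, hn] at this
      flight := h.flight t ht
      impact := h.impact t ht
      contact := h.contact t ht
      mode_right := h.mode_right t ht
      mode_left := h.mode_left t ht }
  · exact
    { nonneg := fun t ht => (h t ht).nonneg
      cont_x := fun t ht => (h t ht).cont_x.mono hsub
      right_deriv_x := fun t ht => (h t ht).right_deriv_x
      right_cont_v := fun t ht => (h t ht).right_cont_v
      deriv_y := fun t ht => (h t ht).deriv_y.mono hsub
      cont_w := fun t ht => (h t ht).cont_w.mono hsub
      flight := fun t ht => (h t ht).flight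
      impact := fun t ht => (h t ht).impact
      contact := fun t ht => (h t ht).contact
      mode_right := fun t ht => (h t ht).mode_right
      mode_left := fun t ht => (h t ht).mode_left }

/-- The rules at one time depend only on the germ of the motion in [0, ∞). This is what allows
gluing. -/
theorem MotionAt.congr (h : MotionAt μ γ u t) (ht : 0 ≤ t) (he : u' =ᶠ[𝓝[Ici 0] t] u) :
    MotionAt μ γ u' t := by
  have het : u' t = u t := he.eq_of_nhdsWithin ht
  have heR : u' =ᶠ[𝓝[>] t] u := he.filter_mono (nhdsWithin_mono _ fun s hs => ht.trans (le_of_lt hs))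
  have he0 : 0 < t → u' =ᶠ[𝓝 t] u := fun h0 => by
    rwa [nhdsWithin_eq_nhds.2 (Ici_mem_nhds h0)] at he
  have heL : 0 < t → u' =ᶠ[𝓝[<] t] u := fun h0 => (he0 h0).filter_mono nhdsWithin_le_nhds
  exact
  { nonneg := het ▸ h.nonneg
    cont_x := h.cont_x.congr_of_eventuallyEq (he.fun_comp State.x) (congrArg State.x het)
    right_deriv_x := het ▸ h.right_deriv_x.congr_of_eventuallyEq (heR.fun_comp State.x)
      (congrArg State.x het)
    right_cont_v := het ▸ h.right_cont_v.congr' (heR.fun_comp State.v).symm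
    deriv_y := het ▸ h.deriv_y.congr_of_eventuallyEq (he.fun_comp State.y) (congrArg State.y het)
    cont_w := h.cont_w.congr_of_eventuallyEq (he.fun_comp State.w) (congrArg State.w het)
    flight := fun h0 hx => by
      rw [het] at hx ⊢
      obtain ⟨h1, h2, h3⟩ := h.flight h0 hx
      exact ⟨h1.congr_of_eventuallyEq ((he0 h0).fun_comp State.x),
        h2.congr_of_eventuallyEq ((he0 h0).fun_comp State.v),
        h3.congr_of_eventuallyEq ((he0 h0).fun_comp State.w)⟩
    impact := fun h0 hx => by
      rw [het] at hx ⊢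
      exact (h.impact h0 hx).congr' ((heL h0).fun_comp State.v).symm
    contact := fun h0 hx => by
      rw [het]
      obtain ⟨h1, h2⟩ := h.contact h0 (by
        filter_upwards [hx, he0 h0] with s h1 h2; rwa [← h2])
      exact ⟨h1.congr_of_eventuallyEq ((he0 h0).fun_comp State.w), h2⟩
    mode_right := h.mode_right.imp
      (fun hm => by filter_upwards [hm, heR] with s h1 h2; rwa [h2])
      (fun hm => by filter_upwards [hm, heR] with s h1 h2; rwa [h2])
    mode_left := fun h0 => (h.mode_left h0).imp
      (fun hm => by filter_upwards [hm, heL h0] with s h1 h2; rwa [h2])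
      (fun hm => by filter_upwards [hm, heL h0] with s h1 h2; rwa [h2]) }

/-! ### Smooth solutions in flight and on the floor -/

/-- `g` solves the equations of free flight (disregarding the floor). -/
def IsFlight (μ γ : ℝ) (g : ℝ → State) : Prop :=
  ∀ t, HasDerivAt (fun s => (g s).x) (g t).v t ∧
    HasDerivAt (fun s => (g s).v) (lowerAcc μ γ (g t)) t ∧
    HasDerivAt (fun s => (g s).y) (g t).w t ∧
    HasDerivAt (fun s => (g s).w) (upperAcc μ γ (g t)) t

/-- `g` solves the equations of rest on the floor (disregarding the sign of the force). -/
def IsRest (μ γ : ℝ) (g : ℝ → State) : Prop :=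
  ∀ t, (g t).x = 0 ∧ (g t).v = 0 ∧ HasDerivAt (fun s => (g s).y) (g t).w t ∧
    HasDerivAt (fun s => (g s).w) (upperAcc μ γ (g t)) t

/-- `g` is a smooth solution that obeys the rules of motion just after `T`. -/
def IsContinuation (μ γ : ℝ) (g : ℝ → State) (T : ℝ) : Prop :=
  (IsFlight μ γ g ∧ ∀ᶠ t in 𝓝[>] T, 0 < (g t).x) ∨
    (IsRest μ γ g ∧ ∀ᶠ t in 𝓝[>] T, floorForce μ γ (g t) ≤ 0)

theorem exists_oscillation (b c T r₀ ρ₀ : ℝ) : ∃ r ρ : ℝ → ℝ, r T = r₀ ∧ ρ T = ρ₀ ∧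
    ∀ t, HasDerivAt r (ρ t) t ∧ HasDerivAt ρ (-b * ρ t - c * r t) t := by
  let A : ℝ × ℝ →L[ℝ] ℝ × ℝ := (ContinuousLinearMap.snd ℝ ℝ ℝ).prod
    (-b • ContinuousLinearMap.snd ℝ ℝ ℝ - c • ContinuousLinearMap.fst ℝ ℝ ℝ)
  let φ : ℝ → ℝ × ℝ := fun t => NormedSpace.exp ((t - T) • A) (r₀, ρ₀)
  have hφ : ∀ t, HasDerivAt φ (A (φ t)) t := by
    intro t
    have h1 := (hasDerivAt_exp_smul_const' A (t - T)).scomp t ((hasDerivAt_id t).sub_const T)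
    have h2 := h1.clm_apply (hasDerivAt_const t ((r₀, ρ₀) : ℝ × ℝ))
    simpa [φ] using h2
  refine ⟨fun t => (φ t).1, fun t => (φ t).2, by simp [φ], by simp [φ], fun t => ⟨?_, ?_⟩⟩
  · exact (hasFDerivAt_fst.comp_hasDerivAt t (hφ t)).congr_deriv (by simp [A])
  · exact (hasFDerivAt_snd.comp_hasDerivAt t (hφ t)).congr_deriv (by simp [A])

/-- The equations decouple: x + y falls freely with acceleration -2γ, and y - x - 1 is a damped
oscillator. -/
theorem exists_isFlight (μ γ : ℝ) (s : State) (T : ℝ) : ∃ g, IsFlight μ γ g ∧ g T = s := by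
  obtain ⟨r, ρ, hr, hρ, hd⟩ := exists_oscillation (2 * μ) 1 T (s.y - s.x - 1) (s.w - s.v)
  let X : ℝ → ℝ := fun t => s.x + s.y + (s.v + s.w) * (t - T) - γ * (t - T) ^ 2
  let V : ℝ → ℝ := fun t => s.v + s.w - 2 * γ * (t - T)
  have hX : ∀ t, HasDerivAt X (V t) t := fun t => by
    have h1 := (hasDerivAt_id t).sub_const T
    have := ((h1.const_mul (s.v + s.w)).const_add (s.x + s.y)).sub ((h1.pow 2).const_mul γ)
    refine this.congr_deriv ?_
    simp only [V, id]; ring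
  have hV : ∀ t, HasDerivAt V (-2 * γ) t := fun t => by
    have := ((((hasDerivAt_id t).sub_const T).const_mul (2 * γ))).const_sub (s.v + s.w)
    refine this.congr_deriv ?_
    ring
  refine ⟨fun t => ⟨(X t - r t - 1) / 2, (V t - ρ t) / 2, (X t + r t + 1) / 2, (V t + ρ t) / 2⟩,
    fun t => ⟨?_, ?_, ?_, ?_⟩, ?_⟩
  · exact (((hX t).sub (hd t).1).sub_const 1).div_const 2
  · refine (((hV t).sub (hd t).2).div_const 2).congr_deriv ?_
    simp only [lowerAcc]; ring
  · exact (((hX t).add (hd t).1).add_const 1).div_const 2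
  · refine (((hV t).add (hd t).2).div_const 2).congr_deriv ?_
    simp only [upperAcc]; ring
  · ext <;> simp only [X, V, hr, hρ] <;> ring

theorem exists_isRest (μ γ : ℝ) (s : State) (hx : s.x = 0) (hv : s.v = 0) (T : ℝ) :
    ∃ g, IsRest μ γ g ∧ g T = s := by
  obtain ⟨r, ρ, hr, hρ, hd⟩ := exists_oscillation μ (1 / 2) T (s.y - (1 - 2 * γ)) s.w
  refine ⟨fun t => ⟨0, 0, r t + (1 - 2 * γ), ρ t⟩, fun t => ⟨rfl, rfl, ?_, ?_⟩, ?_⟩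
  · exact (hd t).1.add_const _
  · refine (hd t).2.congr_deriv ?_
    simp only [upperAcc]; ring
  · ext <;> simp [hr, hρ, hx, hv]

theorem eventually_pos_right_of_hasDerivAt {g : ℝ → ℝ} {c T : ℝ} (hg : HasDerivAt g c T)
    (h0 : g T = 0) (hc : 0 < c) : ∀ᶠ t in 𝓝[>] T, 0 < g t := by
  have h1 := (hasDerivWithinAt_iff_tendsto_slope' (by simp)).1 (hg.hasDerivWithinAt (s := Ioi T))
  filter_upwards [h1.eventually (lt_mem_nhds hc), self_mem_nhdsWithin] with t h2 h3
  rw [slope_def_field, h0, sub_zero] at h2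
  exact (div_pos_iff_of_pos_right (sub_pos.2 h3)).1 h2

theorem eventually_pos_right_of_deriv {g g' : ℝ → ℝ} {T : ℝ} (hg : ∀ t, HasDerivAt g (g' t) t)
    (h0 : 0 ≤ g T) (hc : ∀ᶠ t in 𝓝[>] T, 0 < g' t) : ∀ᶠ t in 𝓝[>] T, 0 < g t := by
  obtain ⟨b, hb, hP⟩ := mem_nhdsGT_iff_exists_Ioo_subset.1 hc
  filter_upwards [Ioo_mem_nhdsGT hb] with t ht
  have : StrictMonoOn g (Icc T t) := strictMonoOn_of_deriv_pos (convex_Icc T t)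
    (fun s _ => (hg s).continuousAt.continuousWithinAt) fun s hs => by
      rw [interior_Icc] at hs
      rw [(hg s).deriv]
      exact hP ⟨hs.1, hs.2.trans ht.2⟩
  exact h0.trans_lt (this (left_mem_Icc.2 ht.1.le) (right_mem_Icc.2 ht.1.le) ht.1)

theorem IsFlight.hasDerivAt_lowerAcc {g : ℝ → State} (h : IsFlight μ γ g) (t : ℝ) :
    HasDerivAt (fun s => lowerAcc μ γ (g s)) ((g t).w / 2 + μ * upperAcc μ γ (g t)
      - μ * lowerAcc μ γ (g t) - (g t).v / 2) t := by
  obtain ⟨h1, h2, h3, h4⟩ := h t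
  exact (((h3.div_const 2).const_add _).add (h4.const_mul μ) |>.sub (h2.const_mul μ)).sub
    (h1.div_const 2)

theorem IsRest.hasDerivAt_floorForce {g : ℝ → State} (h : IsRest μ γ g) (t : ℝ) :
    HasDerivAt (fun s => floorForce μ γ (g s)) ((g t).w / 2 + μ * upperAcc μ γ (g t)) t := by
  obtain ⟨h1, h2, h3, h4⟩ := h t
  exact (((h3.div_const 2).add (h4.const_mul μ)).sub_const _).sub_const _

/-- The ball can move on from every admissible state. -/
theorem exists_isContinuation (hγ : 0 < γ) (s : State) (hx : 0 ≤ s.x) (hv : s.x = 0 → 0 ≤ s.v)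
    (T : ℝ) : ∃ g, IsContinuation μ γ g T ∧ g T = s := by
  obtain ⟨g, hg, hgT⟩ := exists_isFlight μ γ s T
  have flight : (∀ᶠ t in 𝓝[>] T, 0 < (g t).x) → ∃ g, IsContinuation μ γ g T ∧ g T = s :=
    fun h => ⟨g, Or.inl ⟨hg, h⟩, hgT⟩
  have flight' : 0 ≤ s.v → (∀ᶠ t in 𝓝[>] T, 0 < lowerAcc μ γ (g t)) →
      ∃ g, IsContinuation μ γ g T ∧ g T = s := fun hv h =>
    flight (eventually_pos_right_of_deriv (fun t => (hg t).1) (by rwa [hgT])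
      (eventually_pos_right_of_deriv (fun t => (hg t).2.1) (by rwa [hgT]) h))
  rcases hx.eq_or_lt with hx | hx
  swap
  · refine flight ?_
    have := (hg T).1.continuousAt.tendsto.mono_left (nhdsWithin_le_nhds (s := Ioi T))
    exact this.eventually (lt_mem_nhds (by rwa [hgT]))
  rcases (hv hx.symm).eq_or_lt with hv | hv
  swap
  · exact flight (eventually_pos_right_of_hasDerivAt (hg T).1 (by rw [hgT, ← hx]) (by rwa [hgT]))
  obtain ⟨k, hk, hkT⟩ := exists_isRest μ γ s hx.symm hv.symm T
  have rest : (∀ᶠ t in 𝓝[>] T, 0 < -floorForce μ γ (k t)) →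
      ∃ g, IsContinuation μ γ g T ∧ g T = s :=
    fun h => ⟨k, Or.inr ⟨hk, h.mono fun t ht => by linarith⟩, hkT⟩
  have hF : lowerAcc μ γ s = floorForce μ γ s := by
    simp only [lowerAcc, floorForce, ← hx, ← hv]; ring
  -- The lower mass is on the floor without velocity. A force that is negative just afterwards gives
  -- rest, a positive one gives flight; if the force vanishes, its derivative decides.
  rcases lt_trichotomy (floorForce μ γ s) 0 with hf | hf | hf
  · refine rest ?_
    have := (hk.hasDerivAt_floorForce T).continuousAt.tendsto.mono_left
      (nhdsWithin_le_nhds (s := Ioi T))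
    filter_upwards [this.eventually (gt_mem_nhds (by rwa [hkT]))] with t ht using neg_pos.2 ht
  · have hf0 : -γ - 1 / 2 + s.y / 2 + μ * s.w = 0 := by rw [floorForce] at hf; linarith
    rcases lt_trichotomy (s.w / 2 + μ * upperAcc μ γ s) 0 with hq | hq | hq
    · refine rest (eventually_pos_right_of_hasDerivAt
        (c := -(s.w / 2 + μ * upperAcc μ γ s)) ?_ (by rw [hkT, hf, neg_zero]) (neg_pos.2 hq))
      have := (hk.hasDerivAt_floorForce T).neg
      rwa [hkT] at this
    · -- the force decreases to second order
      refine rest ?_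
      let q : ℝ → ℝ := fun t => 2 * μ * γ - (k t).w / 2
      have hup : ∀ t, upperAcc μ γ (k t) = -2 * γ - floorForce μ γ (k t) := fun t => by
        simp only [upperAcc, floorForce, (hk t).1, (hk t).2.1]; ring
      have hqT : q T = 0 := by
        have h1 := hup T
        rw [hkT, hf] at h1
        rw [h1] at hq
        simp only [q, hkT]; linarith
      have hq' : ∀ᶠ t in 𝓝[>] T, 0 < q t := by
        refine eventually_pos_right_of_hasDerivAt (c := γ) ?_ hqT hγ
        have := ((hk T).2.2.2.div_const 2).const_sub (2 * μ * γ)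
        refine this.congr_deriv ?_
        rw [hup, hkT, hf]; ring
      -- With F the floor force, -F' - μ F = q, so exp(μ t) (-F) has derivative exp(μ t) q. Since q
      -- vanishes at T with slope γ, F becomes negative.
      have hE : ∀ t, HasDerivAt (fun t => Real.exp (μ * t) * -floorForce μ γ (k t))
          (Real.exp (μ * t) * q t) t := fun t => by
        have e1 : HasDerivAt (fun t => Real.exp (μ * t)) (Real.exp (μ * t) * μ) t := by
          simpa using ((hasDerivAt_id t).const_mul μ).exp
        refine (e1.mul (hk.hasDerivAt_floorForce t).neg).congr_deriv ?_
        rw [hup]; simp only [q, Pi.neg_apply]; ring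
      filter_upwards [eventually_pos_right_of_deriv hE (by rw [hkT, hf]; simp)
        (hq'.mono fun t ht => mul_pos (Real.exp_pos _) ht)] with t ht
      exact pos_of_mul_pos_right ht (Real.exp_pos _).le
    · refine flight' hv.le (eventually_pos_right_of_hasDerivAt (hg.hasDerivAt_lowerAcc T)
        (by rw [hgT, hF, hf]) ?_)
      rw [hgT, hF, hf, ← hv]
      linarith
  · refine flight' hv.le ?_
    have := (hg.hasDerivAt_lowerAcc T).continuousAt.tendsto.mono_left
      (nhdsWithin_le_nhds (s := Ioi T))
    exact this.eventually (lt_mem_nhds (by rwa [hgT, hF]))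

/-! ### Smooth solutions as motions -/

variable {μ γ : ℝ} {u g : ℝ → State}

theorem MotionAt.of_isFlight (hg : IsFlight μ γ g) {t : ℝ} (hx : 0 < (g t).x) :
    MotionAt μ γ g t := by
  obtain ⟨h1, h2, h3, h4⟩ := hg t
  have hev : ∀ᶠ s in 𝓝 t, 0 < (g s).x := h1.continuousAt.eventually (lt_mem_nhds hx)
  exact
  { nonneg := hx.le
    cont_x := h1.continuousAt.continuousWithinAt
    right_deriv_x := h1.hasDerivWithinAt
    right_cont_v := h2.continuousAt.tendsto.mono_left nhdsWithin_le_nhds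
    deriv_y := h3.hasDerivWithinAt
    cont_w := h4.continuousAt.continuousWithinAt
    flight := fun _ _ => ⟨h1, h2, h4⟩
    impact := fun _ h => absurd h hx.ne'
    contact := fun _ h => absurd h.self_of_nhds hx.ne'
    mode_right := Or.inl (hev.filter_mono nhdsWithin_le_nhds)
    mode_left := fun _ => Or.inl (hev.filter_mono nhdsWithin_le_nhds) }

theorem MotionAt.of_isRest (hg : IsRest μ γ g) {t : ℝ} (hf : floorForce μ γ (g t) ≤ 0) :
    MotionAt μ γ g t := by
  obtain ⟨h1, h2, h3, h4⟩ := hg t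
  have hx : (fun s => (g s).x) = fun _ => 0 := funext fun s => (hg s).1
  have hv : (fun s => (g s).v) = fun _ => 0 := funext fun s => (hg s).2.1
  exact
  { nonneg := h1.ge
    cont_x := by rw [hx]; exact continuousWithinAt_const
    right_deriv_x := by rw [hx, h2]; exact hasDerivWithinAt_const _ _ _
    right_cont_v := by rw [hv, h2]; exact tendsto_const_nhds
    deriv_y := h3.hasDerivWithinAt
    cont_w := h4.continuousAt.continuousWithinAt
    flight := fun _ h => absurd h1 h.ne'
    impact := fun _ _ => by rw [hv, h2, neg_zero]; exact tendsto_const_nhds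
    contact := fun _ _ => ⟨h4, hf⟩
    mode_right := Or.inr (.of_forall fun s => (hg s).1)
    mode_left := fun _ => Or.inr (.of_forall fun s => (hg s).1) }

namespace IsContinuation

theorem eventually_motionAt {T : ℝ} (hg : IsContinuation μ γ g T) :
    ∀ᶠ t in 𝓝[>] T, MotionAt μ γ g t := by
  rcases hg with ⟨hg, h⟩ | ⟨hg, h⟩
  · exact h.mono fun t ht => .of_isFlight hg ht
  · exact h.mono fun t ht => .of_isRest hg ht

theorem hasDerivAt {T : ℝ} (hg : IsContinuation μ γ g T) (t : ℝ) :
    HasDerivAt (fun s => (g s).x) (g t).v t ∧ ContinuousAt (fun s => (g s).v) t ∧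
    HasDerivAt (fun s => (g s).y) (g t).w t ∧
    HasDerivAt (fun s => (g s).w) (upperAcc μ γ (g t)) t := by
  rcases hg with ⟨hg, h⟩ | ⟨hg, h⟩
  · obtain ⟨h1, h2, h3, h4⟩ := hg t
    exact ⟨h1, h2.continuousAt, h3, h4⟩
  · obtain ⟨h1, h2, h3, h4⟩ := hg t
    have hx : (fun s => (g s).x) = fun _ => 0 := funext fun s => (hg s).1
    have hv : (fun s => (g s).v) = fun _ => 0 := funext fun s => (hg s).2.1
    refine ⟨?_, ?_, h3, h4⟩
    · rw [hx, h2]; exact hasDerivAt_const _ _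
    · rw [hv]; exact continuousAt_const

theorem mode_right {T : ℝ} (hg : IsContinuation μ γ g T) :
    (∀ᶠ s in 𝓝[>] T, 0 < (g s).x) ∨ (∀ᶠ s in 𝓝[>] T, (g s).x = 0) := by
  rcases hg with ⟨hg, h⟩ | ⟨hg, h⟩
  · exact Or.inl h
  · exact Or.inr (.of_forall fun s => (hg s).1)

/-- A continuation from time `0` is a motion for a short time. -/
theorem exists_isMotion (hg : IsContinuation μ γ g 0) (h0 : 0 ≤ (g 0).x) :
    ∃ T > (0 : ℝ), IsMotion μ γ (T : EReal) g := by
  obtain ⟨T, hT, hm⟩ := mem_nhdsGT_iff_exists_Ioo_subset.1 hg.eventually_motionAt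
  refine ⟨T, hT, isMotion_iff_motionAt.2 fun t ht => ?_⟩
  rw [timeDomain_coe] at ht
  rcases ht.1.eq_or_lt with rfl | ht0
  · obtain ⟨h1, h2, h3, h4⟩ := hg.hasDerivAt 0
    exact
    { nonneg := h0
      cont_x := h1.continuousAt.continuousWithinAt
      right_deriv_x := h1.hasDerivWithinAt
      right_cont_v := h2.tendsto.mono_left nhdsWithin_le_nhds
      deriv_y := h3.hasDerivWithinAt
      cont_w := h4.continuousAt.continuousWithinAt
      flight := fun h => absurd h (lt_irrefl _)
      impact := fun h => absurd h (lt_irrefl _)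
      contact := fun h => absurd h (lt_irrefl _)
      mode_right := hg.mode_right
      mode_left := fun h => absurd h (lt_irrefl _) }
  · exact hm ⟨ht0, ht.2⟩

end IsContinuation

/-! ### Extension of motions to all times -/

/-- A function that is given left of `T` and has limits there has a left derivative at `T`. -/
theorem hasDerivWithinAt_Iic_of_eventually {f k k' : ℝ → ℝ} {T l' : ℝ} (hf : f =ᶠ[𝓝[<] T] k)
    (hl : Tendsto k (𝓝[<] T) (𝓝 (f T))) (hl' : Tendsto k' (𝓝[<] T) (𝓝 l'))
    (hd : ∀ᶠ s in 𝓝[<] T, HasDerivAt k (k' s) s) : HasDerivWithinAt f l' (Iic T) T := by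
  have h1 : ∀ᶠ s in 𝓝[<] T, HasDerivAt f (k' s) s := by
    filter_upwards [hd, eventually_eventually_left hf] with s h1 h2
    exact h1.congr_of_eventuallyEq h2
  refine hasDerivWithinAt_Iic_of_tendsto_deriv (s := {s | HasDerivAt f (k' s) s} ∩ Iio T)
    (fun s hs => hs.1.differentiableAt.differentiableWithinAt) ?_
    (inter_mem h1 self_mem_nhdsWithin) (hl'.congr' ?_)
  · exact (hl.congr' hf.symm).mono_left (nhdsWithin_mono _ inter_subset_right)
  · filter_upwards [h1] with s hs using hs.deriv.symm

theorem hasDerivAt_of_left_right {f : ℝ → ℝ} {f' T : ℝ} (hl : HasDerivWithinAt f f' (Iic T) T)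
    (hr : HasDerivWithinAt f f' (Ici T) T) : HasDerivAt f f' T := by
  have := hl.union hr
  rwa [Iic_union_Ici, hasDerivWithinAt_univ] at this

/-- Every motion on a bounded time interval can be continued for a short time. -/
theorem IsMotion.exists_extension {T : ℝ} (h : IsMotion μ γ T u) (hμ : 0 < μ) (hγ : 0 < γ)
    (hT : 0 < T) : ∃ T' > T, ∃ u', IsMotion μ γ (T' : EReal) u' ∧ EqOn u u' (Ico 0 T) := by
  obtain ⟨x, v, y, w, hx0, hv0, lx, lv, ly, lw⟩ := h.exists_limit hμ hγ hT
  -- The continuation starts from the left limit, with the velocity reflected if the ball is on the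
  -- floor.
  obtain ⟨g, hg, hgT⟩ := exists_isContinuation (μ := μ) hγ ⟨x, if x = 0 then -v else v, y, w⟩ hx0
    (fun h => by simp only at h ⊢; rw [if_pos h]; linarith [hv0 h]) T
  obtain ⟨T', hT', hm⟩ := mem_nhdsGT_iff_exists_Ioo_subset.1 hg.eventually_motionAt
  let u' : ℝ → State := fun t => if t < T then u t else g t
  have hu'T : u' T = ⟨x, if x = 0 then -v else v, y, w⟩ := by simp [u', hgT]
  have hul : u' =ᶠ[𝓝[<] T] u := by
    filter_upwards [self_mem_nhdsWithin] with t ht using if_pos ht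
  have hur : u' =ᶠ[𝓝[≥] T] g := by
    filter_upwards [self_mem_nhdsWithin] with t ht using if_neg (not_lt.2 ht)
  have hur' : u' =ᶠ[𝓝[>] T] g := hur.filter_mono (nhdsWithin_mono _ Ioi_subset_Ici_self)
  have hdom : ∀ᶠ t in 𝓝[<] T, t ∈ timeDomain T ∧ 0 < t := by
    filter_upwards [Ioo_mem_nhdsLT hT] with t ht
    rw [timeDomain_coe]; exact ⟨⟨ht.1.le, ht.2⟩, ht.1⟩
  obtain ⟨g1, g2, g3, g4⟩ := hg.hasDerivAt T
  have hguT : g T = u' T := by rw [hgT, hu'T]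
  rw [hguT] at g1 g3 g4
  have r1 : HasDerivWithinAt (fun s => (u' s).x) (u' T).v (Ici T) T :=
    g1.hasDerivWithinAt.congr_of_eventuallyEq (hur.fun_comp State.x) (congrArg State.x hguT.symm)
  have r2 : Tendsto (fun s => (u' s).v) (𝓝[>] T) (𝓝 (u' T).v) := by
    rw [← hguT]
    exact (g2.tendsto.mono_left nhdsWithin_le_nhds).congr' (hur'.fun_comp State.v).symm
  have r3 : HasDerivWithinAt (fun s => (u' s).y) (u' T).w (Ici T) T :=
    g3.hasDerivWithinAt.congr_of_eventuallyEq (hur.fun_comp State.y) (congrArg State.y hguT.symm)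
  have r4 : HasDerivWithinAt (fun s => (u' s).w) (upperAcc μ γ (u' T)) (Ici T) T :=
    g4.hasDerivWithinAt.congr_of_eventuallyEq (hur.fun_comp State.w) (congrArg State.w hguT.symm)
  have dy : ∀ᶠ s in 𝓝[<] T, HasDerivAt (fun s => (u s).y) (u s).w s :=
    hdom.mono fun s hs => (h.deriv_y s hs.1).hasDerivAt (timeDomain_mem_nhds hs.1 hs.2)
  have dw : ∀ᶠ s in 𝓝[<] T, HasDerivAt (fun s => (u s).w) (upperAcc μ γ (u s)) s := by
    rcases h.mode_end hμ hγ hT with hm | hm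
    · filter_upwards [hm, hdom] with s h1 h2 using (h.flight s h2.1 h2.2 h1).2.2
    · filter_upwards [eventually_eventually_left hm, hdom] with s h1 h2
      exact (h.contact s h2.1 h2.2 h1).1
  have lup : Tendsto (fun s => upperAcc μ γ (u s)) (𝓝[<] T) (𝓝 (upperAcc μ γ ⟨x, v, y, w⟩)) :=
    (((lx.div_const 2).const_add _).add (lv.const_mul μ) |>.sub (lw.const_mul μ)).sub
      (ly.div_const 2)
  have llo : Tendsto (fun s => lowerAcc μ γ (u s)) (𝓝[<] T) (𝓝 (lowerAcc μ γ ⟨x, v, y, w⟩)) :=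
    (((ly.div_const 2).const_add _).add (lw.const_mul μ) |>.sub (lv.const_mul μ)).sub
      (lx.div_const 2)
  have l3 : HasDerivWithinAt (fun s => (u' s).y) w (Iic T) T :=
    hasDerivWithinAt_Iic_of_eventually (hul.fun_comp State.y) (by simp only [hu'T]; exact ly) lw dy
  have l4 : HasDerivWithinAt (fun s => (u' s).w) (upperAcc μ γ ⟨x, v, y, w⟩) (Iic T) T :=
    hasDerivWithinAt_Iic_of_eventually (hul.fun_comp State.w) (by simp only [hu'T]; exact lw) lup dw
  have hmotT : MotionAt μ γ u' T :=
  { nonneg := by rw [hu'T]; exact hx0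
    cont_x := by
      refine (continuousAt_iff_continuous_left'_right'.2 ⟨?_, ?_⟩).continuousWithinAt
      · rw [ContinuousWithinAt, hu'T]; exact lx.congr' (hul.fun_comp State.x).symm
      · exact r1.continuousWithinAt.mono Ioi_subset_Ici_self
    right_deriv_x := r1.mono Ioi_subset_Ici_self
    right_cont_v := r2
    deriv_y := (hasDerivAt_of_left_right (by rw [hu'T]; exact l3) r3).hasDerivWithinAt
    cont_w := (continuousAt_iff_continuous_left_right.2
      ⟨l4.continuousWithinAt, r4.continuousWithinAt⟩).continuousWithinAt
    flight := fun _ hx => by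
      have hxne : x ≠ 0 := by rw [hu'T] at hx; exact ne_of_gt hx
      have huT : u' T = ⟨x, v, y, w⟩ := by rw [hu'T, if_neg hxne]
      rcases hg with ⟨hg, -⟩ | ⟨hg, -⟩
      swap
      · exact absurd (hguT ▸ (hg T).1) hx.ne'
      have hev : ∀ᶠ s in 𝓝[<] T, 0 < (u s).x :=
        lx.eventually (lt_mem_nhds (lt_of_le_of_ne hx0 hxne.symm))
      refine ⟨hasDerivAt_of_left_right ?_ r1, hasDerivAt_of_left_right ?_ ?_,
        hasDerivAt_of_left_right (by rw [huT]; exact l4) r4⟩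
      · rw [huT]
        refine hasDerivWithinAt_Iic_of_eventually (hul.fun_comp State.x) (by simp only [huT]; exact lx)
          lv ?_
        filter_upwards [hev, hdom] with s h1 h2 using (h.flight s h2.1 h2.2 h1).1
      · rw [huT]
        refine hasDerivWithinAt_Iic_of_eventually (hul.fun_comp State.v) (by simp only [huT]; exact lv)
          llo ?_
        filter_upwards [hev, hdom] with s h1 h2 using (h.flight s h2.1 h2.2 h1).2.1
      · have := (hg T).2.1
        rw [hguT] at this
        exact this.hasDerivWithinAt.congr_of_eventuallyEq (hur.fun_comp State.v)
          (congrArg State.v hguT.symm)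
    impact := fun _ hx => by
      rw [hu'T] at hx ⊢
      simp only at hx
      simp only [if_pos hx, neg_neg]
      exact lv.congr' (hul.fun_comp State.v).symm
    contact := fun _ hx => by
      have hx1 : x = 0 := by have := hx.self_of_nhds; rwa [hu'T] at this
      rcases hg with ⟨-, hg⟩ | ⟨hg, hf⟩
      · have h2 := hx.filter_mono (nhdsWithin_le_nhds (s := Ioi T))
        obtain ⟨s, h3, h4, h5⟩ := (hg.and (h2.and hur')).exists
        rw [h5] at h4
        exact absurd h4 h3.ne'
      · have hv : v = 0 := by
          have := (hg T).2.1
          rw [hgT] at this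
          simpa [hx1] using this
        have huT : u' T = ⟨x, v, y, w⟩ := by rw [hu'T, if_pos hx1, hv, neg_zero]
        refine ⟨hasDerivAt_of_left_right (by rw [huT]; exact l4) r4, ?_⟩
        rw [← hguT]
        exact le_of_tendsto ((hg.hasDerivAt_floorForce T).continuousAt.tendsto.mono_left
          (nhdsWithin_le_nhds (s := Ioi T))) hf
    mode_right := hg.mode_right.imp
      (fun hm => by filter_upwards [hm, hur'] with s h1 h2; rwa [h2])
      (fun hm => by filter_upwards [hm, hur'] with s h1 h2; rwa [h2])
    mode_left := fun _ => (h.mode_end hμ hγ hT).imp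
      (fun hm => by filter_upwards [hm, hul] with s h1 h2; rwa [h2])
      (fun hm => by filter_upwards [hm, hul] with s h1 h2; rwa [h2]) }
  refine ⟨T', hT', u', isMotion_iff_motionAt.2 fun t ht => ?_, fun t ht => (if_pos ht.2).symm⟩
  rw [timeDomain_coe] at ht
  rcases lt_trichotomy t T with htT | rfl | htT
  · refine (isMotion_iff_motionAt.1 h t (by rw [timeDomain_coe]; exact ⟨ht.1, htT⟩)).congr ht.1 ?_
    filter_upwards [mem_nhdsWithin_of_mem_nhds (Iio_mem_nhds htT)] with s hs using if_pos hs
  · exact hmotT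
  · have : MotionAt μ γ g t := hm ⟨htT, ht.2⟩
    refine this.congr ht.1 ?_
    filter_upwards [mem_nhdsWithin_of_mem_nhds (Ioi_mem_nhds htT)] with s hs
    exact if_neg (not_lt.2 (le_of_lt hs))

/-- Every motion on a bounded time interval can be continued to all times. -/
theorem IsMotion.exists_global_extension {T : ℝ} (h : IsMotion μ γ T u) (hμ : 0 < μ) (hγ : 0 < γ)
    (hT : 0 < T) : ∃ u', IsMotion μ γ ⊤ u' ∧ EqOn u' u (Ico 0 T) := by
  -- Zorn's lemma on motions extending `u`, ordered by extension. Chains are bounded by their union,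
  -- and a maximal element with finite end time would contradict `exists_extension`.
  let α := {p : EReal × (ℝ → State) // IsMotion μ γ p.1 p.2 ∧ (T : EReal) ≤ p.1 ∧
    EqOn p.2 u (Ico 0 T)}
  let r : α → α → Prop := fun p q => p.1.1 ≤ q.1.1 ∧ EqOn p.1.2 q.1.2 (timeDomain p.1.1)
  have htrans : ∀ {a b c : α}, r a b → r b c → r a c := fun {a b c} hab hbc =>
    ⟨hab.1.trans hbc.1, fun t ht => (hab.2 ht).trans (hbc.2 (timeDomain_mono hab.1 ht))⟩
  have hub : ∀ c : Set α, IsChain r c → ∃ ub, ∀ p ∈ c, r p ub := by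
    intro c hc
    rcases c.eq_empty_or_nonempty with rfl | ⟨p₀, hp₀⟩
    · exact ⟨⟨⟨T, u⟩, h, le_rfl, fun _ _ => rfl⟩, by simp⟩
    classical
    let k : ℝ → State := fun t =>
      if ht : ∃ p ∈ c, t ∈ timeDomain p.1.1 then ht.choose.1.2 t else u t
    have hk : ∀ p ∈ c, EqOn k p.1.2 (timeDomain p.1.1) := by
      intro p hp t ht
      have hex : ∃ p ∈ c, t ∈ timeDomain p.1.1 := ⟨p, hp, ht⟩
      have hkt : k t = hex.choose.1.2 t := dif_pos hex
      obtain ⟨hq, hq'⟩ := hex.choose_spec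
      rw [hkt]
      by_cases heq : p = hex.choose
      · rw [← heq]
      rcases hc hp hq heq with hr | hr
      · exact (hr.2 ht).symm
      · exact hr.2 hq'
    have hle : ∀ p ∈ c, p.1.1 ≤ sSup ((fun p : α => p.1.1) '' c) :=
      fun p hp => le_sSup ⟨p, hp, rfl⟩
    refine ⟨⟨⟨sSup ((fun p : α => p.1.1) '' c), k⟩, ?_, p₀.2.2.1.trans (hle p₀ hp₀), ?_⟩, ?_⟩
    · refine isMotion_iff_motionAt.2 fun t ht => ?_
      obtain ⟨_, ⟨p, hp, rfl⟩, htp⟩ := lt_sSup_iff.1 ht.2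
      have htp' : t ∈ timeDomain p.1.1 := ⟨ht.1, htp⟩
      refine (isMotion_iff_motionAt.1 p.2.1 t htp').congr ht.1 ?_
      filter_upwards [timeDomain_mem_nhdsWithin htp'] with s hs using hk p hp hs
    · intro t ht
      exact (hk p₀ hp₀ (timeDomain_mono p₀.2.2.1 (by rwa [timeDomain_coe]))).trans (p₀.2.2.2 ht)
    · exact fun p hp => ⟨hle p hp, (hk p hp).symm⟩
  obtain ⟨m, hm⟩ := exists_maximal_of_chains_bounded hub htrans
  obtain ⟨⟨S, k⟩, hk, hS, hEq⟩ := m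
  simp only at hk hS hEq
  induction S with
  | bot => exact absurd hS (by simp)
  | top => exact ⟨k, hk, hEq⟩
  | coe S =>
    have hTS : T ≤ S := EReal.coe_le_coe_iff.1 hS
    obtain ⟨S', hS', k', hk', hkk'⟩ := hk.exists_extension hμ hγ (hT.trans_le hTS)
    have := hm ⟨⟨S', k'⟩, hk', EReal.coe_le_coe_iff.2 (hTS.trans hS'.le), fun t ht =>
      (hkk' ⟨ht.1, ht.2.trans_le hTS⟩).symm.trans (hEq ht)⟩
      ⟨EReal.coe_le_coe_iff.2 hS'.le, by rw [timeDomain_coe]; exact hkk'⟩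
    exact absurd (EReal.coe_le_coe_iff.1 this.1) (not_le.2 hS')

/-- From every initial condition there is a motion for all times. -/
theorem exists_isMotion_startsFrom (hμ : 0 < μ) (hγ : 0 < γ) (s : State) (hs : 0 ≤ s.x) :
    ∃ u, IsMotion μ γ ⊤ u ∧ StartsFrom u s := by
  obtain ⟨g, hg, hg0⟩ := exists_isContinuation (μ := μ) hγ
    ⟨s.x, if s.x = 0 then |s.v| else s.v, s.y, s.w⟩ hs (fun h => by simp only at h ⊢; simp [h]) 0
  obtain ⟨T, hT, hm⟩ := hg.exists_isMotion (by rw [hg0]; exact hs)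
  obtain ⟨u, hu, hEq⟩ := hm.exists_global_extension hμ hγ hT
  have h0 : u 0 = ⟨s.x, if s.x = 0 then |s.v| else s.v, s.y, s.w⟩ :=
    (hEq (left_mem_Ico.2 hT)).trans hg0
  exact ⟨u, hu, by simp [StartsFrom, h0]⟩

/-! ### Convergence to equilibrium -/

theorem energy_nonneg {γ : ℝ} (hγ : 0 < γ) {s : State} (hs : 0 ≤ s.x) : 0 ≤ energy γ s := by
  simp only [energy]; positivity

namespace IsMotion

variable {μ γ : ℝ} {u : ℝ → State}

theorem Icc_subset_top {a b : ℝ} (ha : 0 ≤ a) : Icc a b ⊆ timeDomain ⊤ := by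
  rw [timeDomain_top]; exact fun t ht => ha.trans ht.1

theorem mem_top {t : ℝ} (ht : 0 ≤ t) : t ∈ timeDomain ⊤ := by
  rwa [timeDomain_top]

theorem tendsto_energy (h : IsMotion μ γ ⊤ u) (hμ : 0 < μ) (hγ : 0 < γ) :
    ∃ I, 0 ≤ I ∧ (∀ t ≥ 0, I ≤ energy γ (u t)) ∧
      Tendsto (fun t => energy γ (u t)) atTop (𝓝 I) := by
  set S := (fun t => energy γ (u t)) '' Ici 0
  have hne : S.Nonempty := ⟨_, 0, self_mem_Ici, rfl⟩
  have h0 : ∀ e ∈ S, 0 ≤ e := by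
    rintro _ ⟨t, ht, rfl⟩
    exact energy_nonneg hγ (h.nonneg t (mem_top ht))
  have hle : ∀ t ≥ 0, sInf S ≤ energy γ (u t) := fun t ht => csInf_le ⟨0, h0⟩ ⟨t, ht, rfl⟩
  refine ⟨sInf S, le_csInf hne h0, hle, tendsto_order.2 ⟨fun a ha => ?_, fun a ha => ?_⟩⟩
  · filter_upwards [eventually_ge_atTop 0] with t ht using ha.trans_le (hle t ht)
  · obtain ⟨_, ⟨s, hs, rfl⟩, hsa⟩ := exists_lt_of_csInf_lt hne ha
    filter_upwards [eventually_ge_atTop s] with t ht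
    exact (h.energy_antitone hμ hs ht (mem_top (le_trans hs ht))).trans_lt hsa

/-- The damper acts less and less: in the long run a function whose derivative is `c`, up to an
error `B` and a multiple of the damping velocity, changes on bounded time intervals like
a linear function. -/
theorem eventually_window (h : IsMotion μ γ ⊤ u) (hμ : 0 < μ) (hγ : 0 < γ) {A L ε : ℝ} (hA : 0 ≤ A)
    (hL : 0 < L) (hε : 0 < ε) :
    ∀ᶠ t in atTop, 0 ≤ t ∧ ∀ s ∈ Icc t (t + L), ∀ (g g' : ℝ → ℝ) (S : Set ℝ) (c B : ℝ),
      HasRightDerivOn g g' S → Icc t s ⊆ S →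
      (∀ r ∈ Ico t s, |g' r - c| ≤ A * |(u r).w - (u r).v| + B) →
      |g s - g t - c * (s - t)| ≤ ε + B * (s - t) := by
  obtain ⟨I, -, hI, hlim⟩ := h.tendsto_energy hμ hγ
  -- By Young's inequality A |w - v| ≤ A η + A (w - v)²/(4 η). The choice of η bounds the first part
  -- by ε/2 on a window of length L, and δ does so for the second, which is κ times the dissipation
  -- rate, via the late energy loss.
  set η := ε / (2 * (A + 1) * L) with hη
  have hη0 : 0 < η := by positivity
  set δ := 2 * ε * η * μ / (A + 1) with hδ
  have hδ0 : 0 < δ := by positivity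
  filter_upwards [eventually_ge_atTop 0, hlim.eventually (gt_mem_nhds (show I < I + δ by linarith))]
    with t ht0 htδ
  refine ⟨ht0, fun s hs g g' S c B hg hS hle => ?_⟩
  have hsub : Icc t s ⊆ timeDomain ⊤ := Icc_subset_top ht0
  set κ := A / (4 * η * μ) with hκ
  have hN := (h.hasRightDerivOn_energy.mono hsub).const_mul (-κ)
  have hlin : HasRightDerivOn (fun t => (B + A * η) * t) (fun _ => (B + A * η) * 1) (Icc t s) :=
    HasRightDerivOn.id.const_mul _
  have hg1 := (hg.mono hS).sub ((HasRightDerivOn.id (s := Icc t s)).const_mul c)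
  have hρ : ∀ r, A * |(u r).w - (u r).v| ≤ A * η + -κ * (-μ * ((u r).w - (u r).v) ^ 2) := by
    intro r
    have h1 : |(u r).w - (u r).v| ≤ η + ((u r).w - (u r).v) ^ 2 / (4 * η) := by
      rw [← sub_nonneg]
      have : η + ((u r).w - (u r).v) ^ 2 / (4 * η) - |(u r).w - (u r).v|
          = (2 * η - |(u r).w - (u r).v|) ^ 2 / (4 * η) := by
        field_simp
        rw [← sq_abs ((u r).w - (u r).v)]
        ring
      rw [this]; positivity
    calc A * |(u r).w - (u r).v| ≤ A * (η + ((u r).w - (u r).v) ^ 2 / (4 * η)) := by gcongr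
      _ = _ := by rw [hκ]; field_simp
  have up := hg1.sub_le_sub (hlin.add hN) hs.1 le_rfl fun r hr => by
    have := (abs_le.1 (hle r hr)).2
    linarith [hρ r]
  have lo := (hg1.const_mul (-1)).sub_le_sub (hlin.add hN) hs.1 le_rfl fun r hr => by
    have := (abs_le.1 (hle r hr)).1
    linarith [hρ r]
  have hst : s - t ≤ L := by linarith [hs.2]
  have hst0 : 0 ≤ s - t := sub_nonneg.2 hs.1
  have e1 : A * η * (s - t) ≤ ε / 2 := by
    calc A * η * (s - t) ≤ (A + 1) * η * L := by gcongr; linarith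
      _ = ε / 2 := by rw [hη]; field_simp
  have e2 : κ * (energy γ (u t) - energy γ (u s)) ≤ ε / 2 := by
    have h1 : energy γ (u t) - energy γ (u s) ≤ δ := by
      linarith [hI s (ht0.trans hs.1)]
    have h2 : 0 ≤ κ := by positivity
    calc κ * (energy γ (u t) - energy γ (u s)) ≤ κ * δ := by gcongr
      _ = ε / 2 * (A / (A + 1)) := by rw [hκ, hδ]; field_simp; norm_num
      _ ≤ ε / 2 * 1 := by
        gcongr
        exact (div_le_one (by positivity)).2 (by linarith)
      _ = ε / 2 := mul_one _
  rw [abs_le]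
  constructor <;> linarith

theorem tendsto_zero_of_eventually {g : ℝ → ℝ} (hg : ∀ ε > 0, ∀ᶠ t in atTop, |g t| ≤ ε) :
    Tendsto g atTop (𝓝 0) := by
  rw [Metric.tendsto_nhds]
  intro ε hε
  filter_upwards [hg (ε / 2) (by positivity)] with t ht
  rw [Real.dist_eq, sub_zero]
  linarith

/-- On a late window the stretch p is nearly constant, since its derivative is the damping velocity.
Then w' is nearly -p/2 and w moves by about p L / 2; as w is bounded, a long window forces p to be
small. -/
theorem tendsto_stretch (h : IsMotion μ γ ⊤ u) (hμ : 0 < μ) (hγ : 0 < γ) :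
    Tendsto (fun t => stretch γ (u t)) atTop (𝓝 0) := by
  obtain ⟨C, hC, hbd⟩ := h.exists_bound hμ hγ
  refine tendsto_zero_of_eventually fun ε hε => ?_
  set L := 4 * (2 * C + 2) / ε with hL
  have hL0 : 0 < L := by positivity
  filter_upwards [h.eventually_window hμ hγ zero_le_one hL0 (half_pos hε),
    h.eventually_window hμ hγ hμ.le hL0 one_pos] with t ⟨ht0, h1⟩ ⟨_, h2⟩
  have hp : ∀ s ∈ Icc t (t + L), |stretch γ (u s) - stretch γ (u t)| ≤ ε / 2 := by
    intro s hs
    have := h1 s hs _ _ _ 0 0 h.hasRightDerivOn_stretch (Icc_subset_top ht0)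
      fun r _ => by simp
    simpa using this
  have hend : t + L ∈ Icc t (t + L) := ⟨by linarith, le_rfl⟩
  have h3 := h2 (t + L) hend _ _ _ (-(stretch γ (u t) / 2)) (ε / 4) h.hasRightDerivOn_w
    (Icc_subset_top ht0) fun r hr => by
      have := hp r ⟨hr.1, hr.2.le⟩
      rw [upperAcc_eq_stretch]
      calc |-(stretch γ (u r) / 2) - μ * ((u r).w - (u r).v) - -(stretch γ (u t) / 2)|
          = |-((stretch γ (u r) - stretch γ (u t)) / 2) - μ * ((u r).w - (u r).v)| := by
            congr 1; ring
        _ ≤ |-((stretch γ (u r) - stretch γ (u t)) / 2)| + |μ * ((u r).w - (u r).v)| := abs_sub _ _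
        _ ≤ μ * |(u r).w - (u r).v| + ε / 4 := by
          rw [abs_neg, abs_div, abs_mul, abs_of_pos hμ, abs_of_pos (zero_lt_two' ℝ)]
          linarith
  have hw1 := abs_le.1 (hbd t (mem_top ht0)).2.1
  have hw2 := abs_le.1 (hbd (t + L) (mem_top (by linarith))).2.1
  have hεL : ε * L = 4 * (2 * C + 2) := by rw [hL]; field_simp
  rw [add_sub_cancel_left, abs_le] at h3
  rw [abs_le]
  constructor
  · by_contra! hcon
    have := mul_lt_mul_of_pos_right hcon hL0
    linarith
  · by_contra! hcon
    have := mul_lt_mul_of_pos_right hcon hL0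
    linarith

/-- Once p is small, `w` is nearly constant on late windows. It is the derivative of the bounded
quantity p + x, so a long window forces it to be small. -/
theorem tendsto_w (h : IsMotion μ γ ⊤ u) (hμ : 0 < μ) (hγ : 0 < γ) :
    Tendsto (fun t => (u t).w) atTop (𝓝 0) := by
  obtain ⟨C, hC, hbd⟩ := h.exists_bound hμ hγ
  refine tendsto_zero_of_eventually fun ε hε => ?_
  set L := 8 * C / ε with hL
  have hL0 : 0 < L := by positivity
  have hεL : ε * L = 8 * C := by rw [hL]; field_simp
  have hp := (h.tendsto_stretch hμ hγ).abs
  rw [abs_zero] at hp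
  filter_upwards [h.eventually_window hμ hγ hμ.le hL0 (show 0 < ε / 4 by positivity),
    eventually_forall_ge_atTop.2 (hp.eventually (gt_mem_nhds (show 0 < ε / (2 * L) by positivity)))]
    with t ⟨ht0, h1⟩ h2
  have hw : ∀ s ∈ Icc t (t + L), |(u s).w - (u t).w| ≤ ε / 2 := by
    intro s hs
    have h3 := h1 s hs _ _ _ 0 (ε / (4 * L)) h.hasRightDerivOn_w (Icc_subset_top ht0)
      fun r hr => by
        have := (h2 r hr.1).le
        rw [upperAcc_eq_stretch, sub_zero]
        refine (abs_sub _ _).trans ?_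
        rw [abs_neg, abs_div, abs_mul, abs_of_pos hμ, abs_of_pos (zero_lt_two' ℝ)]
        have e : ε / (2 * L) / 2 = ε / (4 * L) := by field_simp; norm_num
        linarith
    rw [zero_mul, sub_zero] at h3
    have h4 : ε / (4 * L) * (s - t) ≤ ε / (4 * L) * L := by gcongr; linarith [hs.2]
    have e : ε / (4 * L) * L = ε / 4 := by field_simp
    linarith
  have hend : t ≤ t + L := by linarith
  have hz := ((h.hasRightDerivOn_stretch.add h.hasRightDerivOn_x).sub
    (HasRightDerivOn.id.const_mul (u t).w)).abs_sub_le (c := ε / 2) hend (Icc_subset_top ht0)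
    fun r hr => by
      have := hw r ⟨hr.1, hr.2.le⟩
      rwa [sub_add_cancel, mul_one]
  obtain ⟨-, -, x1, p1, -, -⟩ := hbd t (mem_top ht0)
  obtain ⟨-, -, x2, p2, -, -⟩ := hbd (t + L) (mem_top (by linarith))
  have x3 := h.nonneg t (mem_top ht0)
  have x4 := h.nonneg (t + L) (mem_top (by linarith))
  rw [abs_le] at hz p1 p2
  rw [abs_le]
  constructor
  · by_contra! hcon
    have := mul_lt_mul_of_pos_right hcon hL0
    linarith
  · by_contra! hcon
    have := mul_lt_mul_of_pos_right hcon hL0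
    linarith

/-- As w → 0, the height is nearly constant on late windows. If it were not small, there would be a
long uninterrupted flight with acceleration near -2γ, contradicting bounded `v`. -/
theorem tendsto_x (h : IsMotion μ γ ⊤ u) (hμ : 0 < μ) (hγ : 0 < γ) :
    Tendsto (fun t => (u t).x) atTop (𝓝 0) := by
  obtain ⟨C, hC, hbd⟩ := h.exists_bound hμ hγ
  refine tendsto_zero_of_eventually fun ε hε => ?_
  set L := (4 * C + 4) / γ with hL
  have hL0 : 0 < L := by positivity
  have hγL : γ * L = 4 * C + 4 := by rw [hL]; field_simp
  have hp := (h.tendsto_stretch hμ hγ).abs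
  have hw := (h.tendsto_w hμ hγ).abs
  rw [abs_zero] at hp hw
  filter_upwards [h.eventually_window hμ hγ zero_le_one hL0 (show 0 < ε / 4 by positivity),
    h.eventually_window hμ hγ hμ.le hL0 one_pos,
    eventually_forall_ge_atTop.2 (hp.eventually (gt_mem_nhds (show 0 < 2 * γ by positivity))),
    eventually_forall_ge_atTop.2 (hw.eventually (gt_mem_nhds (show 0 < ε / (4 * L) by positivity)))]
    with t ⟨ht0, h1⟩ ⟨_, h2⟩ h3 h4
  have hx : ∀ s ∈ Icc t (t + L), |(u s).x - (u t).x| ≤ ε / 2 := by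
    intro s hs
    have h5 := h1 s hs _ _ _ 0 (ε / (4 * L)) h.hasRightDerivOn_x (Icc_subset_top ht0)
      fun r hr => by
        have h6 := (h4 r hr.1).le
        have h7 := abs_sub ((u r).w) ((u r).w - (u r).v)
        rw [sub_sub_cancel] at h7
        rw [sub_zero]
        linarith
    rw [zero_mul, sub_zero] at h5
    have h6 : ε / (4 * L) * (s - t) ≤ ε / (4 * L) * L := by gcongr; linarith [hs.2]
    have e : ε / (4 * L) * L = ε / 4 := by field_simp
    linarith
  rw [abs_of_nonneg (h.nonneg t (mem_top ht0))]
  by_contra! hcon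
  have hpos : ∀ s ∈ Ioo t (t + L), 0 < (u s).x := fun s hs => by
    have := (abs_le.1 (hx s (Ioo_subset_Icc_self hs))).1
    linarith
  have hv := h.hasRightDerivOn_v ht0 (Ico_subset_Icc_self.trans (Icc_subset_top ht0)) hpos
  have h5 := h2 (t + L / 2) ⟨by linarith, by linarith⟩ _ _ _ (-2 * γ) γ hv
    (fun r hr => ⟨hr.1, by linarith [hr.2]⟩) fun r hr => by
      have h6 := (h3 r hr.1).le
      rw [lowerAcc_eq_stretch]
      calc |-2 * γ + stretch γ (u r) / 2 + μ * ((u r).w - (u r).v) - -2 * γ|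
          = |stretch γ (u r) / 2 + μ * ((u r).w - (u r).v)| := by congr 1; ring
        _ ≤ |stretch γ (u r) / 2| + |μ * ((u r).w - (u r).v)| := abs_add_le _ _
        _ ≤ μ * |(u r).w - (u r).v| + γ := by
          rw [abs_div, abs_mul, abs_of_pos hμ, abs_of_pos (zero_lt_two' ℝ)]
          linarith
  have v1 := abs_le.1 (hbd t (mem_top ht0)).1
  have v2 := abs_le.1 (hbd (t + L / 2) (mem_top (by linarith))).1
  rw [add_sub_cancel_left, abs_le] at h5
  linarith

/-- All other energy terms vanish in the limit, so v² → 2 I. The dissipation rate then tends to 2 μ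
I, which for I > 0 would exhaust the energy. -/
theorem tendsto_v (h : IsMotion μ γ ⊤ u) (hμ : 0 < μ) (hγ : 0 < γ) :
    Tendsto (fun t => (u t).v) atTop (𝓝 0) := by
  obtain ⟨C, hC, hbd⟩ := h.exists_bound hμ hγ
  obtain ⟨I, hI0, -, hlim⟩ := h.tendsto_energy hμ hγ
  have hw := h.tendsto_w hμ hγ
  have hv2 : Tendsto (fun t => (u t).v ^ 2) atTop (𝓝 (2 * I)) := by
    have := ((((hlim.sub ((hw.pow 2).div_const 2)).sub
      ((h.tendsto_x hμ hγ).const_mul (2 * γ))).sub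
      (((h.tendsto_stretch hμ hγ).pow 2).div_const 4)).const_mul 2)
    convert this using 2 with t
    · simp only [energy]; ring
    · norm_num
  have hI : I = 0 := by
    by_contra hne
    have hIpos : 0 < I := lt_of_le_of_ne hI0 (Ne.symm hne)
    have hwv : Tendsto (fun t => (u t).w * (u t).v) atTop (𝓝 0) := by
      refine hw.zero_mul_isBoundedUnder_le ?_
      refine isBoundedUnder_of_eventually_le (a := C) ?_
      filter_upwards [eventually_ge_atTop 0] with t ht using (hbd t (mem_top ht)).1
    have hρ : Tendsto (fun t => ((u t).w - (u t).v) ^ 2) atTop (𝓝 (2 * I)) := by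
      have := (hv2.sub (hwv.const_mul 2)).add (hw.pow 2)
      convert this using 2 with t
      · ring
      · norm_num
    obtain ⟨R, hR⟩ := eventually_atTop.1 ((hρ.eventually (lt_mem_nhds
      (show I < 2 * I by linarith))).and (eventually_ge_atTop 0))
    have hR0 := (hR R le_rfl).2
    set L := (energy γ (u R) + 1) / (μ * I) with hL
    have hE := energy_nonneg hγ (h.nonneg R (mem_top hR0))
    have hL0 : 0 < L := by positivity
    have h1 := h.hasRightDerivOn_energy.sub_le_mul (c := -(μ * I)) (show R ≤ R + L by linarith)
      (Icc_subset_top hR0) fun r hr => by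
        have := mul_le_mul_of_nonneg_left (hR r hr.1).1.le hμ.le
        linarith
    have h2 := energy_nonneg hγ (h.nonneg (R + L) (mem_top (by linarith)))
    have h3 : μ * I * L = energy γ (u R) + 1 := by rw [hL]; field_simp
    rw [add_sub_cancel_left] at h1
    linarith
  rw [hI, mul_zero] at hv2
  have h1 := hv2.sqrt
  simp only [Real.sqrt_sq_eq_abs, Real.sqrt_zero] at h1
  exact (tendsto_zero_iff_abs_tendsto_zero _).2 h1

end IsMotion

/-! ### The bouncing energy of the lower mass -/

/-- The energy of the lower mass in the field of the driving force. -/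
noncomputable def bounceEnergy (μ γ : ℝ) (s : State) : ℝ :=
  s.v ^ 2 / 2 - drive μ γ s * s.x - (μ ^ 2 - 1 / 2) * s.x ^ 2 / 2

namespace IsMotion

variable {μ γ : ℝ} {u : ℝ → State}

theorem hasRightDerivOn_bounceEnergy {T : EReal} (h : IsMotion μ γ T u) :
    HasRightDerivOn (fun t => bounceEnergy μ γ (u t))
      (fun t => -μ * (u t).v ^ 2 - (driveRate μ γ (u t) - μ * drive μ γ (u t)
        + (μ - μ ^ 3) * (u t).x) * (u t).x) (timeDomain T) := by
  have h1 := (h.hasRightDerivOn_sq_v.sub (h.hasRightDerivOn_drive.mul h.hasRightDerivOn_x)).sub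
    ((h.hasRightDerivOn_x.mul h.hasRightDerivOn_x).const_mul ((μ ^ 2 - 1 / 2) / 2))
  have h2 := h1.congr_deriv (k := fun t => -μ * (u t).v ^ 2 - (driveRate μ γ (u t)
      - μ * drive μ γ (u t) + (μ - μ ^ 3) * (u t).x) * (u t).x) fun t _ => by
    simp only [lowerAcc_eq_drive]; ring
  convert h2 using 2 with t
  simp only [bounceEnergy]; ring

/-! ### Limits of the forces -/

theorem tendsto_lowerAcc (h : IsMotion μ γ ⊤ u) (hμ : 0 < μ) (hγ : 0 < γ) :
    Tendsto (fun t => lowerAcc μ γ (u t)) atTop (𝓝 (-2 * γ)) := by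
  simp only [lowerAcc_eq_stretch]
  simpa using (((h.tendsto_stretch hμ hγ).div_const 2).const_add (-2 * γ)).add
    (((h.tendsto_w hμ hγ).sub (h.tendsto_v hμ hγ)).const_mul μ)

theorem tendsto_drive (h : IsMotion μ γ ⊤ u) (hμ : 0 < μ) (hγ : 0 < γ) :
    Tendsto (fun t => drive μ γ (u t)) atTop (𝓝 (-2 * γ)) := by
  simp only [drive_eq_stretch]
  simpa using ((((h.tendsto_stretch hμ hγ).div_const 2).const_add (-2 * γ)).add
    ((h.tendsto_w hμ hγ).const_mul μ)).sub ((h.tendsto_x hμ hγ).const_mul (μ ^ 2 - 1 / 2))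

theorem tendsto_deriv_drive (h : IsMotion μ γ ⊤ u) (hμ : 0 < μ) (hγ : 0 < γ) :
    Tendsto (fun t => driveRate μ γ (u t) - μ * drive μ γ (u t) + (μ - μ ^ 3) * (u t).x)
      atTop (𝓝 0) := by
  have hx := h.tendsto_x hμ hγ
  have := (((((h.tendsto_w hμ hγ).div_const 2).sub_const (2 * μ * γ)).sub
    ((hx.const_mul μ).div_const 2)).sub ((h.tendsto_drive hμ hγ).const_mul μ)).add
    (hx.const_mul (μ - μ ^ 3))
  convert this using 2
  · simp only [driveRate]
  · ring

/-! ### The two outcomes -/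

/-- In the long run, either the lower mass rests on the floor, or all contacts are impacts. -/
theorem eventually_rest_or_bounce (h : IsMotion μ γ ⊤ u) (hμ : 0 < μ) (hγ : 0 < γ) :
    (∃ t₀ ≥ 0, ∀ t ≥ t₀, (u t).x = 0) ∨
      ∃ t₀ ≥ 0, ∀ t ≥ t₀, (u t).x = 0 → (u t).v ≠ 0 := by
  have hx := h.tendsto_x hμ hγ
  have hφ : Tendsto (fun t => -drive μ γ (u t) - (μ ^ 2 - 1 / 2) * (u t).x / 2) atTop
      (𝓝 (2 * γ)) := by
    simpa using (h.tendsto_drive hμ hγ).neg.sub ((hx.const_mul (μ ^ 2 - 1 / 2)).div_const 2)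
  have hf' := (h.tendsto_deriv_drive hμ hγ).abs
  rw [abs_zero] at hf'
  obtain ⟨R, hR⟩ := eventually_atTop.1 (((hφ.eventually (lt_mem_nhds
    (show γ < 2 * γ by linarith))).and (hf'.eventually (gt_mem_nhds one_pos))).and
    (eventually_ge_atTop 0))
  have hR0 := (hR R le_rfl).2
  have hH : ∀ t ≥ R, (u t).v ^ 2 / 2 + γ * (u t).x ≤ bounceEnergy μ γ (u t) := by
    intro t ht
    have h1 := mul_le_mul_of_nonneg_right (hR t ht).1.1.le (h.nonneg t (mem_top (hR0.trans ht)))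
    simp only [bounceEnergy]
    linarith
  -- Since |f'| < 1, the derivative of the bouncing energy is at most x, hence at most H/γ ≤ K H.
  set K := 2 * μ + 1 / γ with hK
  have hK0 : 0 < K := by positivity
  have hle : ∀ t ≥ R, -μ * (u t).v ^ 2 - (driveRate μ γ (u t) - μ * drive μ γ (u t)
        + (μ - μ ^ 3) * (u t).x) * (u t).x ≤ K * bounceEnergy μ γ (u t) := by
    intro t ht
    have h0 := h.nonneg t (mem_top (hR0.trans ht))
    have h1 := mul_le_mul_of_nonneg_left (hH t ht) hK0.le
    have h2 := mul_le_mul_of_nonneg_right (abs_le.1 (hR t ht).1.2.le).1 h0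
    have h3 : K * ((u t).v ^ 2 / 2 + γ * (u t).x) = μ * (u t).v ^ 2 + (u t).x
        + (2 * μ * γ * (u t).x + (u t).v ^ 2 / (2 * γ)) := by rw [hK]; field_simp; ring
    have h4 : 0 ≤ 2 * μ * γ * (u t).x + (u t).v ^ 2 / (2 * γ) := by positivity
    have h5 : 0 ≤ μ * (u t).v ^ 2 := by positivity
    linarith
  have hexp : HasRightDerivOn (fun t => Real.exp (-K * t)) (fun t => Real.exp (-K * t) * -K)
      (timeDomain ⊤) := .of_hasDerivAt fun t _ => by
    simpa using ((hasDerivAt_id t).const_mul (-K)).exp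
  have hmono := hexp.mul h.hasRightDerivOn_bounceEnergy
  -- By Gronwall, a zero of the bouncing energy persists, which means rest. Without zeros, a contact
  -- with zero velocity is impossible, because there the bouncing energy would vanish.
  by_cases hcase : ∃ t₁ ≥ R, bounceEnergy μ γ (u t₁) = 0
  · obtain ⟨t₁, ht₁, h0⟩ := hcase
    refine Or.inl ⟨t₁, hR0.trans ht₁, fun t ht => ?_⟩
    have h1 := hmono.le_of_nonpos ht (Icc_subset_top (hR0.trans ht₁)) fun r hr => by
      have := mul_le_mul_of_nonneg_left (hle r (ht₁.trans hr.1)) (Real.exp_pos (-K * r)).le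
      linarith
    rw [h0, mul_zero] at h1
    have h2 : bounceEnergy μ γ (u t) ≤ 0 := nonpos_of_mul_nonpos_right h1 (Real.exp_pos _)
    have h3 := hH t (ht₁.trans ht)
    have h4 := h.nonneg t (mem_top (hR0.trans (ht₁.trans ht)))
    have h5 : γ * (u t).x ≤ 0 := by nlinarith [sq_nonneg (u t).v]
    exact le_antisymm (nonpos_of_mul_nonpos_right h5 hγ) h4
  · push Not at hcase
    refine Or.inr ⟨R, hR0, fun t ht hxt hvt => hcase t ht ?_⟩
    simp [bounceEnergy, hxt, hvt]

theorem endsInContact (h : IsMotion μ γ ⊤ u) (hμ : 0 < μ) (hγ : 0 < γ) {t₀ : ℝ} (ht₀ : 0 ≤ t₀)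
    (hx : ∀ t ≥ t₀, (u t).x = 0) : EndsInContact μ γ u := by
  refine ⟨⟨t₀, ht₀, fun t ht => ?_⟩, ?_, h.tendsto_w hμ hγ⟩
  · have htpos : 0 < t := ht₀.trans_lt ht
    have hdom : t ∈ timeDomain ⊤ := mem_top htpos.le
    have hev : ∀ᶠ s in 𝓝 t, (u s).x = 0 := by
      filter_upwards [Ioi_mem_nhds ht] with s hs using hx s (le_of_lt hs)
    have hv := h.velocity_eq_zero_of_eventually hdom (hx t (le_of_lt ht))
      (hev.filter_mono nhdsWithin_le_nhds)
    refine ⟨hx t (le_of_lt ht), (h.deriv_y t hdom).hasDerivAt (timeDomain_mem_nhds hdom htpos), ?_⟩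
    refine (h.contact t hdom htpos hev).1.congr_deriv ?_
    simp only [upperAcc, hx t (le_of_lt ht), hv]; ring
  · have := ((h.tendsto_stretch hμ hγ).add (h.tendsto_x hμ hγ)).add_const (1 - 2 * γ)
    convert this using 2 with t
    · simp only [stretch]; ring
    · ring

/-- The ball does not stay in flight for ever. -/
theorem exists_contact (h : IsMotion μ γ ⊤ u) (hμ : 0 < μ) (hγ : 0 < γ) (b : ℝ) :
    ∃ t > b, (u t).x = 0 := by
  by_contra! hcon
  obtain ⟨C, hC, hbd⟩ := h.exists_bound hμ hγ
  obtain ⟨R, hR⟩ := eventually_atTop.1 ((((h.tendsto_lowerAcc hμ hγ).eventually (gt_mem_nhds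
    (show -2 * γ < -γ by linarith))).and (eventually_ge_atTop 0)).and (eventually_gt_atTop b))
  obtain ⟨⟨-, hR0⟩, hRb⟩ := hR R le_rfl
  set L := (2 * C + 1) / γ with hL
  have hL0 : 0 < L := by positivity
  have hγL : γ * L = 2 * C + 1 := by rw [hL]; field_simp
  have hv := h.hasRightDerivOn_v (b := R + L + 1) hR0
    (Ico_subset_Icc_self.trans (Icc_subset_top hR0)) fun s hs =>
      lt_of_le_of_ne (h.nonneg s (mem_top (hR0.trans hs.1.le)))
        (Ne.symm (hcon s (hRb.trans hs.1)))
  have h1 := hv.sub_le_mul (c := -γ) (show R ≤ R + L by linarith)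
    (fun r hr => ⟨hr.1, by linarith [hr.2]⟩) fun r hr => (hR r hr.1).1.1.le
  have v1 := abs_le.1 (hbd R (mem_top hR0)).1
  have v2 := abs_le.1 (hbd (R + L) (mem_top (by linarith))).1
  rw [add_sub_cancel_left] at h1
  linarith

/-! ### A single flight -/

/-- When the forces are nearly constant, the velocities before and after a flight of duration `τ`
are close to `γ τ`, and their squares differ by nearly `2 μ γ² τ³ / 3`. -/
theorem flight_estimate {T : EReal} (h : IsMotion μ γ T u) (hμ : 0 < μ) (hγ : 0 < γ) {a b ε : ℝ}
    (ha : 0 ≤ a) (hab : a < b) (hT : b ∈ timeDomain T) (hxa : (u a).x = 0) (hxb : (u b).x = 0)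
    (hpos : ∀ s ∈ Ioo a b, 0 < (u s).x) (hε0 : 0 ≤ ε) (hε1 : ε ≤ 1)
    (hacc : ∀ t ∈ Ico a b, |lowerAcc μ γ (u t) + 2 * γ| ≤ ε)
    (hf : ∀ t ∈ Ico a b, |driveRate μ γ (u t) - μ * drive μ γ (u t) + (μ - μ ^ 3) * (u t).x| ≤ ε) :
    |(u a).v - γ * (b - a)| ≤ ε * (b - a) ∧ |(u b).v - γ * (b - a)| ≤ 2 * ε * (b - a) ∧
      |(u a).v ^ 2 - (u b).v ^ 2 - 2 * μ * γ ^ 2 / 3 * (b - a) ^ 3| ≤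
        2 * (4 * μ * (γ + 1) + (γ + 2)) * ε * (b - a) ^ 3 := by
  set τ := b - a with hτ
  have hτ0 : 0 < τ := sub_pos.2 hab
  have hsub : Icc a b ⊆ timeDomain T := Icc_subset_timeDomain ha hT
  have dv := h.hasRightDerivOn_v ha (Ico_subset_Icc_self.trans hsub) hpos
  have hv : ∀ t ∈ Ico a b, |(u t).v - (u a).v + 2 * γ * (t - a)| ≤ ε * τ := by
    intro t ht
    have h1 := (dv.add (HasRightDerivOn.id.const_mul (2 * γ))).abs_sub_le (c := ε) ht.1
      (fun r hr => ⟨hr.1, hr.2.trans_lt ht.2⟩) fun r hr => by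
        rw [mul_one]; exact hacc r ⟨hr.1, hr.2.trans ht.2⟩
    have h2 : ε * (t - a) ≤ ε * τ := by gcongr; linarith [ht.2]
    have h3 : (u t).v - (u a).v + 2 * γ * (t - a)
      = (u t).v + 2 * γ * t - ((u a).v + 2 * γ * a) := by ring
    rw [h3]; exact h1.trans h2
  have dq : ∀ c : ℝ, HasRightDerivOn (fun t => c * (t - a) ^ 2) (fun t => 2 * c * (t - a))
      (timeDomain T) := fun c => .of_hasDerivAt fun t _ => by
    refine ((((hasDerivAt_id t).sub_const a).pow 2).const_mul c).congr_deriv ?_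
    simp only [id]; ring
  -- The height vanishes at both ends, so the mean of v is zero, while v is nearly v(a) - 2γ (t -
  -- a), whose mean is v(a) - γ τ.
  have hVa : |(u a).v - γ * τ| ≤ ε * τ := by
    have h1 := ((h.hasRightDerivOn_x.sub (HasRightDerivOn.id.const_mul (u a).v)).add
      (dq γ)).abs_sub_le (c := ε * τ) hab.le hsub fun r hr => by
        have := hv r hr
        rwa [mul_one]
    rw [hxa, hxb] at h1
    have h2 : 0 - (u a).v * b + γ * (b - a) ^ 2 - (0 - (u a).v * a + γ * (a - a) ^ 2)
        = -(((u a).v - γ * τ) * τ) := by rw [hτ]; ring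
    rw [h2, abs_neg, abs_mul, abs_of_pos hτ0] at h1
    exact le_of_mul_le_mul_right h1 hτ0
  have hVb : |(u b).v - γ * τ| ≤ 2 * ε * τ := by
    have hlim := h.impact b hT (ha.trans_lt hab) hxb
    have h1 : Tendsto (fun t => |(u t).v - (u a).v + 2 * γ * (t - a)|) (𝓝[<] b)
        (𝓝 |-(u b).v - (u a).v + 2 * γ * (b - a)|) := by
      refine ((hlim.sub_const _).add ?_).abs
      exact (Continuous.tendsto (by fun_prop) b).mono_left nhdsWithin_le_nhds
    have h2 := le_of_tendsto h1 (by
      filter_upwards [Ioo_mem_nhdsLT hab] with t ht using hv t ⟨ht.1.le, ht.2⟩)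
    rw [abs_le] at h2 hVa ⊢
    constructor <;> linarith
  refine ⟨hVa, hVb, ?_⟩
  -- Velocity profile of the ideal parabolic flight, from γ τ down to -γ τ.
  let l : ℝ → ℝ := fun t => γ * τ - 2 * γ * (t - a)
  have hvl : ∀ t ∈ Ico a b, |(u t).v - l t| ≤ 2 * ε * τ := by
    intro t ht
    have h1 := hv t ht
    rw [abs_le] at h1 hVa ⊢
    simp only [l]
    constructor <;> linarith
  have hl : ∀ t ∈ Ico a b, |l t| ≤ γ * τ := by
    intro t ht
    have h1 := mul_nonneg hγ.le (sub_nonneg.2 ht.1)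
    have h2 := mul_nonneg hγ.le (sub_nonneg.2 ht.2.le)
    rw [abs_le]
    simp only [l, hτ]
    constructor <;> linarith
  have hετ : ε * τ ≤ τ := by nlinarith
  have hvτ : ∀ t ∈ Ico a b, |(u t).v| ≤ (γ + 2) * τ := by
    intro t ht
    have := abs_add_le ((u t).v - l t) (l t)
    rw [sub_add_cancel] at this
    linarith [hvl t ht, hl t ht]
  have hx : ∀ t ∈ Ico a b, |(u t).x| ≤ (γ + 2) * τ * τ := by
    intro t ht
    have h1 := h.hasRightDerivOn_x.abs_sub_le (c := (γ + 2) * τ) ht.1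
      (fun r hr => hsub ⟨hr.1, hr.2.trans ht.2.le⟩) fun r hr => hvτ r ⟨hr.1, hr.2.trans ht.2⟩
    rw [hxa, sub_zero] at h1
    refine h1.trans ?_
    gcongr
    linarith [ht.2]
  -- This antiderivative of l² increases by γ² τ³ / 3 over the flight, which gives the main term of
  -- the friction loss.
  have dl : HasRightDerivOn (fun t => -(l t ^ 3) / (6 * γ)) (fun t => l t ^ 2) (timeDomain T) :=
    .of_hasDerivAt fun t _ => by
      have h1 : HasDerivAt l (-(2 * γ)) t := by
        have := (((hasDerivAt_id t).sub_const a).const_mul (2 * γ)).const_sub (γ * τ)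
        rwa [mul_one] at this
      refine ((h1.pow 3).neg.div_const (6 * γ)).congr_deriv ?_
      field_simp
      push_cast
      ring
  have hH := (h.hasRightDerivOn_bounceEnergy.add (dl.const_mul μ)).abs_sub_le
    (c := (4 * μ * (γ + 1) + (γ + 2)) * ε * τ ^ 2) hab.le hsub fun t ht => by
      have h1 : |(u t).v ^ 2 - l t ^ 2| ≤ 4 * (γ + 1) * ε * τ ^ 2 := by
        have h2 : |(u t).v + l t| ≤ 2 * (γ + 1) * τ := by
          have := abs_add_le (u t).v (l t)
          linarith [hvτ t ht, hl t ht]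
        calc |(u t).v ^ 2 - l t ^ 2| = |(u t).v - l t| * |(u t).v + l t| := by
              rw [← abs_mul]; congr 1; ring
          _ ≤ 2 * ε * τ * (2 * (γ + 1) * τ) := by
              gcongr
              exact hvl t ht
          _ = _ := by ring
      set F := driveRate μ γ (u t) - μ * drive μ γ (u t) + (μ - μ ^ 3) * (u t).x
      have h3 : |F * (u t).x| ≤ ε * ((γ + 2) * τ * τ) := by
        rw [abs_mul]
        exact mul_le_mul (hf t ht) (hx t ht) (abs_nonneg _) hε0
      calc |-μ * (u t).v ^ 2 - F * (u t).x + μ * l t ^ 2|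
          = |-(μ * ((u t).v ^ 2 - l t ^ 2)) - F * (u t).x| := by congr 1; ring
        _ ≤ |-(μ * ((u t).v ^ 2 - l t ^ 2))| + |F * (u t).x| := abs_sub _ _
        _ ≤ μ * (4 * (γ + 1) * ε * τ ^ 2) + ε * ((γ + 2) * τ * τ) := by
          rw [abs_neg, abs_mul, abs_of_pos hμ]
          gcongr
        _ = _ := by ring
  -- At contacts the bouncing energy is v²/2.
  have e1 : bounceEnergy μ γ (u b) + μ * (-(l b ^ 3) / (6 * γ)) -
      (bounceEnergy μ γ (u a) + μ * (-(l a ^ 3) / (6 * γ)))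
      = -(((u a).v ^ 2 - (u b).v ^ 2 - 2 * μ * γ ^ 2 / 3 * τ ^ 3) / 2) := by
    simp only [bounceEnergy, hxa, hxb, l, ← hτ]
    field_simp
    ring
  rw [e1, abs_neg, abs_div, abs_of_pos (zero_lt_two' ℝ)] at hH
  linarith

end IsMotion

/-! ### Sequences -/

/-- A locally finite set of reals that is unbounded above is the range of a sequence that increases
to infinity. -/
theorem exists_strictMono_range_eq {S : Set ℝ} (hfin : ∀ b, (S ∩ Iic b).Finite)
    (hunb : ∀ b, ∃ s ∈ S, b < s) :
    ∃ t : ℕ → ℝ, StrictMono t ∧ range t = S ∧ Tendsto t atTop atTop := by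
  obtain ⟨s₀, hs₀, -⟩ := hunb 0
  obtain ⟨m, ⟨hm, hm'⟩, hmin⟩ := (hfin s₀).exists_minimal ⟨s₀, hs₀, le_refl s₀⟩
  have hbot : ∀ s ∈ S, m ≤ s := fun s hs => by
    rcases le_total s s₀ with h | h
    · by_contra! hlt
      exact hlt.not_ge (hmin ⟨hs, h⟩ hlt.le)
    · exact le_trans hm' h
  -- With a least element, no greatest one and finite intervals, S is order isomorphic to ℕ.
  let _ : OrderBot S := { bot := ⟨m, hm⟩, bot_le := fun s => hbot s s.2 }
  have : NoMaxOrder S := ⟨fun s => by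
    obtain ⟨r, hr, hsr⟩ := hunb s
    exact ⟨⟨r, hr⟩, hsr⟩⟩
  let _ : LocallyFiniteOrder S := LocallyFiniteOrder.ofFiniteIcc fun a b => by
    refine Set.Finite.of_finite_image (f := Subtype.val) ((hfin b).subset ?_)
      Subtype.val_injective.injOn
    rintro _ ⟨s, hs, rfl⟩
    exact ⟨s.2, hs.2⟩
  let _ := LinearLocallyFiniteOrder.succOrder S
  let _ := LinearLocallyFiniteOrder.predOrder S
  let e : S ≃o ℕ := orderIsoNatOfLinearSuccPredArch
  have hmono : StrictMono fun n => (e.symm n : ℝ) := fun i j hij => e.symm.strictMono hij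
  have hrange : range (fun n => (e.symm n : ℝ)) = S := by
    ext s
    refine ⟨?_, fun hs => ⟨e ⟨s, hs⟩, by simp⟩⟩
    rintro ⟨n, rfl⟩
    exact (e.symm n).2
  refine ⟨_, hmono, hrange, tendsto_atTop_atTop_of_monotone hmono.monotone fun b => ?_⟩
  obtain ⟨s, hs, hbs⟩ := hunb b
  rw [← hrange] at hs
  obtain ⟨n, rfl⟩ := hs
  exact ⟨n, hbs.le⟩

/-- If `V (n + 1) ≈ V n - (μ / (3 γ)) (V n)²` and `V ≈ γ τ`, then `τ n ∼ 3 / (μ n)`. -/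
theorem isEquivalent_of_tendsto {μ γ : ℝ} (hμ : 0 < μ) (hγ : 0 < γ) {V τ : ℕ → ℝ}
    (hV : ∀ n, 0 < V n) (hτ : ∀ n, 0 < τ n)
    (h1 : Tendsto (fun n => V n / τ n) atTop (𝓝 γ))
    (h2 : Tendsto (fun n => V (n + 1) / τ n) atTop (𝓝 γ))
    (h3 : Tendsto (fun n => (V n ^ 2 - V (n + 1) ^ 2) / τ n ^ 3) atTop
      (𝓝 (2 * μ * γ ^ 2 / 3))) :
    τ ~[atTop] fun n : ℕ => 3 / μ * (1 / (n : ℝ)) := by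
  -- With V' the next velocity, 1/V' - 1/V = (V² - V'²)/(V V' (V + V')). Dividing numerator and
  -- denominator by τ³ gives the limit (2 μ γ²/3)/(2 γ³).
  have h4 : Tendsto (fun n => (V (n + 1))⁻¹ - (V n)⁻¹) atTop (𝓝 (μ / (3 * γ))) := by
    have := h3.div ((h1.mul h2).mul (h1.add h2)) (by positivity)
    have e : 2 * μ * γ ^ 2 / 3 / (γ * γ * (γ + γ)) = μ / (3 * γ) := by field_simp; ring
    rw [e] at this
    refine this.congr fun n => ?_
    have := hV n; have := hV (n + 1); have := hτ n
    have : V n + V (n + 1) ≠ 0 := by positivity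
    simp only [Pi.div_apply]
    field_simp
    ring
  have h5 : Tendsto (fun n : ℕ => (n : ℝ)⁻¹ * ((V n)⁻¹ - (V 0)⁻¹)) atTop (𝓝 (μ / (3 * γ))) :=
    h4.cesaro.congr fun n => by rw [Finset.sum_range_sub fun n => (V n)⁻¹]
  have h6 : Tendsto (fun n : ℕ => (n : ℝ)⁻¹ * (V n)⁻¹) atTop (𝓝 (μ / (3 * γ))) := by
    have := h5.add ((tendsto_inv_atTop_nhds_zero_nat (𝕜 := ℝ)).mul_const (V 0)⁻¹)
    rw [zero_mul, add_zero] at this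
    refine this.congr fun n => ?_
    ring
  refine isEquivalent_of_tendsto_one ?_
  have h7 := ((h1.mul h6).inv₀ (by positivity)).const_mul (μ / 3)
  have e : μ / 3 * (γ * (μ / (3 * γ)))⁻¹ = 1 := by field_simp
  rw [e] at h7
  refine h7.congr fun n => ?_
  have := hV n; have := hτ n
  simp only [Pi.div_apply]
  -- At n = 0 both sides are 0, by the convention for division by zero.
  rcases Nat.eq_zero_or_pos n with rfl | hn
  · simp
  · have : (0 : ℝ) < n := Nat.cast_pos.2 hn
    field_simp

/-- Late flights run between consecutive impacts, and the force errors tend to 0, so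
`flight_estimate` with arbitrarily small ε supplies the limits required by
`isEquivalent_of_tendsto`. -/
theorem IsMotion.bouncesForever {μ γ : ℝ} {u : ℝ → State} (h : IsMotion μ γ ⊤ u) (hμ : 0 < μ)
    (hγ : 0 < γ) {t₀ : ℝ} (ht₀ : 0 ≤ t₀) (hx : ∀ t ≥ t₀, (u t).x = 0 → (u t).v ≠ 0) :
    BouncesForever μ u := by
  have himp : ∀ s ≥ t₀, (u s).x = 0 → s ∈ impactTimes ⊤ u := fun s hs hxs =>
    ⟨IsMotion.mem_top (ht₀.trans hs), hxs, hx s hs hxs⟩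
  obtain ⟨t, hmono, hrange, hlim⟩ := exists_strictMono_range_eq (S := impactTimes ⊤ u)
    (fun b => by
      -- The end time b + 1 puts all impacts up to and including b into a half-open interval.
      refine ((h.restrict (T' := ((b + 1 : ℝ) : EReal)) le_top).finite_impactTimes hμ hγ).subset ?_
      rintro s ⟨⟨hs, hs'⟩, hsb⟩
      refine ⟨?_, hs'⟩
      rw [timeDomain_coe]
      exact ⟨hs.1, lt_of_le_of_lt hsb (lt_add_one b)⟩)
    (fun b => by
      obtain ⟨s, hs, hxs⟩ := h.exists_contact hμ hγ (max b t₀)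
      exact ⟨s, himp s ((le_max_right _ _).trans hs.le) hxs, (le_max_left _ _).trans_lt hs⟩)
  refine ⟨t, hmono, hrange, hlim, ⟨t₀, himp⟩, ?_⟩
  have ht : ∀ n, t n ∈ impactTimes ⊤ u := fun n => hrange ▸ mem_range_self n
  have hV : ∀ n, 0 < (u (t n)).v := fun n =>
    lt_of_le_of_ne (h.velocity_nonneg (ht n).1 (ht n).2.1) (ht n).2.2.symm
  have hτ : ∀ n, 0 < t (n + 1) - t n := fun n => sub_pos.2 (hmono (Nat.lt_succ_self n))
  have key : ∀ ε, 0 < ε → ε ≤ 1 → ∀ᶠ n in atTop,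
      |(u (t n)).v / (t (n + 1) - t n) - γ| ≤ ε ∧
      |(u (t (n + 1))).v / (t (n + 1) - t n) - γ| ≤ 2 * ε ∧
      |((u (t n)).v ^ 2 - (u (t (n + 1))).v ^ 2) / (t (n + 1) - t n) ^ 3 - 2 * μ * γ ^ 2 / 3| ≤
        2 * (4 * μ * (γ + 1) + (γ + 2)) * ε := by
    intro ε hε hε1
    have ha := ((h.tendsto_lowerAcc hμ hγ).add_const (2 * γ)).abs
    rw [show |-2 * γ + 2 * γ| = 0 by simp] at ha
    have hf := (h.tendsto_deriv_drive hμ hγ).abs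
    rw [abs_zero] at hf
    filter_upwards [hlim.eventually (eventually_forall_ge_atTop.2
      ((ha.eventually (gt_mem_nhds hε)).and (hf.eventually (gt_mem_nhds hε)))),
      hlim.eventually (eventually_ge_atTop t₀)] with n hn hn₀
    obtain ⟨e1, e2, e3⟩ := h.flight_estimate hμ hγ (ht n).1.1 (hmono (Nat.lt_succ_self n))
      (ht (n + 1)).1 (ht n).2.1 (ht (n + 1)).2.1 (fun s hs => by
        refine lt_of_le_of_ne (h.nonneg s (IsMotion.mem_top ((ht n).1.1.trans hs.1.le)))
          fun h0 => ?_
        -- A contact strictly between t n and t (n + 1) would be an impact, hence a member of the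
        -- sequence with an index strictly between n and n + 1.
        have := himp s (hn₀.trans hs.1.le) h0.symm
        rw [← hrange] at this
        obtain ⟨k, rfl⟩ := this
        have h1 := hmono.lt_iff_lt.1 hs.1
        have h2 := hmono.lt_iff_lt.1 hs.2
        omega) hε.le hε1 (fun s hs => (hn s hs.1).1.le) (fun s hs => (hn s hs.1).2.le)
    have hτn := hτ n
    set τ := t (n + 1) - t n
    have hdiv : ∀ {X c d k : ℝ}, 0 < k → |X - c * k| ≤ d * k → |X / k - c| ≤ d := by
      intro X c d k hk hX
      have : X / k - c = (X - c * k) / k := by field_simp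
      rw [this, abs_div, abs_of_pos hk, div_le_iff₀ hk]
      exact hX
    exact ⟨hdiv hτn e1, hdiv hτn e2, hdiv (pow_pos hτn 3) e3⟩
  have htend : ∀ {g : ℕ → ℝ} {c K : ℝ}, 0 < K →
      (∀ ε, 0 < ε → ε ≤ 1 → ∀ᶠ n in atTop, |g n - c| ≤ K * ε) → Tendsto g atTop (𝓝 c) := by
    intro g c K hK hg
    rw [Metric.tendsto_nhds]
    intro δ hδ
    filter_upwards [hg (min 1 (δ / (2 * K))) (by positivity) (min_le_left _ _)] with n hn
    rw [Real.dist_eq]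
    calc |g n - c| ≤ K * min 1 (δ / (2 * K)) := hn
      _ ≤ K * (δ / (2 * K)) := by gcongr; exact min_le_right _ _
      _ = δ / 2 := by field_simp
      _ < δ := half_lt_self hδ
  exact isEquivalent_of_tendsto hμ hγ hV hτ
    (htend one_pos fun ε h0 h1 => (key ε h0 h1).mono fun n hn => by rw [one_mul]; exact hn.1)
    (htend two_pos fun ε h0 h1 => (key ε h0 h1).mono fun n hn => hn.2.1)
    (htend (K := 2 * (4 * μ * (γ + 1) + (γ + 2))) (by positivity)
      fun ε h0 h1 => (key ε h0 h1).mono fun n hn => hn.2.2)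

end BouncingBall

theorem theorem1 (μ γ : ℝ) (hμ : 0 < μ) (hγ : 0 < γ)
    (s : BouncingBall.State) (hs : 0 ≤ s.x) :
    -- the motion exists for all positive times
    (∃ u : ℝ → BouncingBall.State,
      BouncingBall.IsMotion μ γ ⊤ u ∧ BouncingBall.StartsFrom u s) ∧
    -- there is no inelastic collapse
    (∀ (T : ℝ) (u : ℝ → BouncingBall.State), 0 < T →
      BouncingBall.IsMotion μ γ (T : EReal) u → BouncingBall.StartsFrom u s →
        (BouncingBall.impactTimes (T : EReal) u).Finite ∧
        ∃ u' : ℝ → BouncingBall.State, BouncingBall.IsMotion μ γ ⊤ u' ∧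
          ∀ t : ℝ, 0 ≤ t → t < T → u' t = u t) ∧
    -- the two possible outcomes
    (∀ u : ℝ → BouncingBall.State,
      BouncingBall.IsMotion μ γ ⊤ u → BouncingBall.StartsFrom u s →
        BouncingBall.EndsInContact μ γ u ∨ BouncingBall.BouncesForever μ u) := by

  refine ⟨BouncingBall.exists_isMotion_startsFrom hμ hγ s hs, fun T u hT hu _ => ?_,
    fun u hu _ => ?_⟩
  · obtain ⟨u', hu', hEq⟩ := hu.exists_global_extension hμ hγ hT
    exact ⟨hu.finite_impactTimes hμ hγ, u', hu', fun t h0 ht => hEq ⟨h0, ht⟩⟩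
  · rcases hu.eventually_rest_or_bounce hμ hγ with ⟨t₀, ht₀, hx⟩ | ⟨t₀, ht₀, hx⟩
    · exact Or.inl (hu.endsInContact hμ hγ ht₀ hx)
    · exact Or.inr (hu.bouncesForever hμ hγ ht₀ hx)
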